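/- Let $p>2$ be a prime, $\mathbb F$ a field of characteristic $p$, and $M=(c_{ij})\in\mathbb F^{2\times 4}$. Let $E=\langle e_1,\dots,e_4\rangle\cong(\mathbb Z/p)^4$ act on $\mathbb F[V_M]=\mathbb F[x,y,z]$ by algebra automorphisms with $x\cdot e_j=x$, $y\cdot e_j=y+c_{1j}x$, $z\cdot e_j=z+2c_{1j}y+(c_{1j}^2+c_{2j})x$, and let $\mathbb F[V_M]^E$ be the ring of invariants. Let $\Gamma(M)$ be the $10\times 4$ matrix whose rows are $r_{2m+1}=(c_{1j}^{p^m})_j$ and $r_{2m+2}=(c_{2j}^{p^m})_j$, $0\le m\le 4$, and let $\gamma_{ijkl}$ be its $4\times4$ minor on rows $i,j,k,l$. Let $N_M(f)$ be the product of the elements of the $E$-orbit of $f$, and $\delta=y^2-xz$. Use the graded reverse lexicographic order with $x<y<z$; $\mathrm{LM}$ and $\mathrm{LT}$ denote lead monomial and lead term. A subset $\mathcal B$ of an algebra $A\subseteq\mathbb F[x,y,z]$ is a SAGBI basis for $A$ if the lead monomials of the elements of $\mathcal B$ generate the lead term algebra of $A$. A tête-à-tête for a sequence $h$ of polynomials is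 a pair $(h^I,h^J)$ with $\mathrm{LM}(h^I)=\mathrm{LM}(h^J)$; it is non-trivial if $I$ and $J$ have disjoint supports. Choose $c$ with $\mathrm{LT}(h^I)=\mathrm{LT}(ch^J)$. Subducting the tête-à-tête to zero means reducing $h^I-ch^J$ to $0$ by repeatedly replacing $f\neq0$ by $f-c'h^K$ with $\mathrm{LT}(f)=\mathrm{LT}(c'h^K)$; this writes $h^I-ch^J$ as the polynomial $P(h)$, where $P$ is the sum of the terms $c'T^K$ used, and the resulting relation is $T^I-cT^J-P(T)$. Assume $\gamma_{1234}=0$, $\gamma_{1235}=0$ and $\gamma_{1357}\neq0$. (a) If $\gamma_{1257}\ne0$, put $\alpha=\gamma_{1357}/\gamma_{1257}$, $h_1=y^p+\alpha\,\delta x^{p-2}+\frac{\gamma_{2357}}{\gamma_{1257}}\,yx^{p-1}$ and $$\widetilde h_2=N_M(y)-h_1^{p^3}+\alpha^{p^3}h_1^{2p^2}x^{p^4-2p^3}-2\alpha^{p^3+p^2}h_1^{p^2+2p}x^{p^4-p^3-2p^2}+4\alpha^{p^3+p^2+p}h_1^{p^2+p+2}x^{p^4-p^3-p^2-2p}.$$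 Then $\widetilde h_2=8\alpha^{p^3+p^2+p+1}x^{p^4-p^3-p^2-p-2}\,h_2$ for a polynomial $h_2$, and $\{x,h_1,h_2,N_M(z)\}$ is a SAGBI basis for $\mathbb F[V_M]^E$. The ring $\mathbb F[V_M]^E$ is a hypersurface: it is generated by $x,h_1,h_2,N_M(z)$, which are homogeneous of degrees $1,\ p,\ p^3+p^2+p+2,\ p^4$. The pair $(h_2^p,h_1^{p^3+p^2+p+2})$ is a non-trivial tête-à-tête that subducts to zero, and the ideal of relations among the generators is generated by the one nonzero relation obtained from any such subduction, which has degree $p^4+p^3+p^2+2p$. (b) If $\gamma_{1257}=0$, then there is $a\in\mathbb F$ with $c_{2j}=a\,c_{1j}$ for all $j$, and $V_M$ is the symmetric square of a two-dimensional representation: with $E$ acting on $\mathbb F[u,v]$ by $u\cdot e_j=u$, $v\cdot e_j=v+c_{1j}u$, there is an $E$-equivariant algebra homomorphism $\mathbb F[x,y,z]\to\mathbb F[u,v]$ that maps the linear forms bijectively onto the quadratic forms. With $z'=z-ay$ and $\delta'=y^2-xz'$, the set $\{x,\delta',N_M(y),N_M(z')\}$ is a SAGBI basis for $\mathbb F[V_M]^E$.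 The ring is a hypersurface: it is generated by these four elements, which are homogeneous of degrees $1,2,p^4,p^4$. The pair $(\delta'^{\,p^4},N_M(y)^2)$ is a non-trivial tête-à-tête that subducts to zero, and the ideal of relations among the generators is generated by the one nonzero relation obtained from any such subduction, which has degree $2p^4$. -/

import Mathlib

open MvPolynomial

/-! The polynomial ring `F[x, y, z]` is `MvPolynomial (Fin 3) F` with `x = X 0`, `y = X 1`,
`z = X 2`. -/

/-! ### The graded reverse lexicographic order with `x < y < z` -/

/-- Exponent vectors of monomials in `x, y, z`, to be ordered by `grevlex`. -/
def GrevlexExp : Type := Fin 3 →₀ ℕ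

namespace GrevlexExp

noncomputable instance : AddCommMonoid GrevlexExp :=
  inferInstanceAs (AddCommMonoid (Fin 3 →₀ ℕ))

/-- The total degree, then the degree in `y, z`, then the degree in `z`. Comparing these triples
lexicographically is the graded reverse lexicographic order with `x < y < z`; see
`grevlex_lt_iff`. -/
def key (a : Fin 3 →₀ ℕ) : ℕ ×ₗ (ℕ ×ₗ ℕ) :=
  toLex (a 0 + a 1 + a 2, toLex (a 1 + a 2, a 2))

theorem key_injective : Function.Injective key := by
  intro a b h
  simp only [key, EmbeddingLike.apply_eq_iff_eq, Prod.mk.injEq] at h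
  ext i
  fin_cases i <;> simp <;> omega

noncomputable instance : LinearOrder GrevlexExp :=
  LinearOrder.lift' (fun a : GrevlexExp => key a) key_injective

theorem key_add (a b : Fin 3 →₀ ℕ) : key (a + b) = key a + key b := by
  have h : ∀ i, (a + b) i = a i + b i := fun _ => rfl
  simp only [key, h, ← toLex_add, Prod.mk_add_mk]
  rw [show a 0 + b 0 + (a 1 + b 1) + (a 2 + b 2) = a 0 + a 1 + a 2 + (b 0 + b 1 + b 2) by omega,
    show a 1 + b 1 + (a 2 + b 2) = a 1 + a 2 + (b 1 + b 2) by omega]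

/-- The exponent vectors as elements of the ordered monoid `GrevlexExp`. -/
noncomputable def ofExp : (Fin 3 →₀ ℕ) ≃+ GrevlexExp where
  toEquiv := Equiv.refl _
  map_add' _ _ := rfl

theorem ofExp_le (a b : Fin 3 →₀ ℕ) : ofExp a ≤ ofExp b ↔ key a ≤ key b := Iff.rfl

theorem ofExp_lt (a b : Fin 3 →₀ ℕ) : ofExp a < ofExp b ↔ key a < key b := Iff.rfl

instance : IsOrderedAddMonoid GrevlexExp where
  add_le_add_left a b h c := by
    obtain ⟨a, rfl⟩ := ofExp.surjective a
    obtain ⟨b, rfl⟩ := ofExp.surjective b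
    obtain ⟨c, rfl⟩ := ofExp.surjective c
    rw [← map_add, ← map_add, ofExp_le, key_add, key_add]
    exact add_le_add_left ((ofExp_le a b).1 h) _

instance : WellFoundedLT GrevlexExp :=
  ⟨InvImage.wf (fun a : GrevlexExp => key a) wellFounded_lt⟩

theorem key_mono {a b : Fin 3 →₀ ℕ} (h : a ≤ b) : key a ≤ key b := by
  have h0 := h 0
  have h1 := h 1
  have h2 := h 2
  simp only [key, Prod.Lex.toLex_le_toLex]
  omega

end GrevlexExp

/-- The graded reverse lexicographic order on the monomials in `x, y, z` with `x < y < z`. -/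
noncomputable def grevlex : MonomialOrder (Fin 3) where
  syn := GrevlexExp
  toSyn := GrevlexExp.ofExp
  toSyn_monotone := fun _ _ h => GrevlexExp.key_mono h

/-- The usual description of the order: compare total degrees; for equal total degrees, the
monomial with the smaller exponent of the smallest variable in which they differ is larger. -/
theorem grevlex_lt_iff (a b : Fin 3 →₀ ℕ) :
    grevlex.toSyn a < grevlex.toSyn b ↔
      a 0 + a 1 + a 2 < b 0 + b 1 + b 2 ∨
        (a 0 + a 1 + a 2 = b 0 + b 1 + b 2 ∧ (b 0 < a 0 ∨ (b 0 = a 0 ∧ b 1 < a 1))) := by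
  change GrevlexExp.ofExp a < GrevlexExp.ofExp b ↔ _
  simp only [GrevlexExp.ofExp_lt, GrevlexExp.key, Prod.Lex.toLex_lt_toLex]
  omega

section Invariants

variable {F : Type*} [Field F]

/-- The homomorphism `σ : F² → GL₃(F)`. -/
def sigmaMat (c₁ c₂ : F) : Matrix (Fin 3) (Fin 3) F :=
  !![1, 2 * c₁, c₁ ^ 2 + c₂; 0, 1, c₁; 0, 0, 1]

/-- The image of a row of `M` under the group element `e₁ ^ n₁ ⋯ e₄ ^ n₄`: the element
`∑ j, n_j * c_j` of `F`. The group `E = (ℤ/p)⁴` is written additively as `Fin 4 → ZMod p`. -/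
def rowValue (p : ℕ) [CharP F p] (c : Fin 4 → F) (n : Fin 4 → ZMod p) : F :=
  ∑ j, ZMod.castHom (dvd_refl p) F (n j) * c j

/-- The action on `F[x, y, z] = F[V_M]` of the group element `n = e₁ ^ n₁ ⋯ e₄ ^ n₄`, where
`e_j` acts by right multiplication of the row vectors `x = [0 0 1]`, `y = [0 1 0]`, `z = [1 0 0]`
with `σ (c₁ⱼ, c₂ⱼ)`. -/
noncomputable def act (p : ℕ) [CharP F p] (M : Matrix (Fin 2) (Fin 4) F) (n : Fin 4 → ZMod p) :
    MvPolynomial (Fin 3) F →ₐ[F] MvPolynomial (Fin 3) F :=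
  aeval fun i => ∑ j : Fin 3,
    C (sigmaMat (rowValue p (M 0) n) (rowValue p (M 1) n) i.rev j.rev) * X j

/-- The ring of invariants `F[V_M]^E`. -/
def invariantRing (p : ℕ) [CharP F p] (M : Matrix (Fin 2) (Fin 4) F) :
    Subalgebra F (MvPolynomial (Fin 3) F) where
  carrier := {f | ∀ n, act p M n f = f}
  mul_mem' ha hb n := by rw [map_mul, ha n, hb n]
  add_mem' ha hb n := by rw [map_add, ha n, hb n]
  algebraMap_mem' r n := AlgHom.commutes _ r

open Classical in
/-- The norm `N_M(f)`: the product of the elements of the `E`-orbit of `f`. -/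
noncomputable def orbitNorm (p : ℕ) [Fact p.Prime] [CharP F p] (M : Matrix (Fin 2) (Fin 4) F)
    (f : MvPolynomial (Fin 3) F) : MvPolynomial (Fin 3) F :=
  ∏ g ∈ Finset.univ.image (fun n : Fin 4 → ZMod p => act p M n f), g

/-- Row number `i` (counted from `1`) of the matrix `Γ(M)` with rows
`r₁ = M₁, r₂ = M₂, r₃ = M₁ ^ p, r₄ = M₂ ^ p, r₅ = M₁ ^ (p²), …` (entrywise powers). -/
def gammaRow (p : ℕ) (M : Matrix (Fin 2) (Fin 4) F) (i : ℕ) (j : Fin 4) : F :=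
  M (if i % 2 = 1 then 0 else 1) j ^ p ^ ((i - 1) / 2)

/-- The minor `γ_{ijkl}(M)` of `Γ(M)` on the rows `i, j, k, l` (counted from `1`). -/
def gamma (p : ℕ) (M : Matrix (Fin 2) (Fin 4) F) (i j k l : ℕ) : F :=
  Matrix.det (Matrix.of ![gammaRow p M i, gammaRow p M j, gammaRow p M k, gammaRow p M l])

/-! ### SAGBI bases and subduction -/

/-- The algebra generated by the lead monomials of the nonzero elements of `S`. -/
noncomputable def leadAlgebra (S : Set (MvPolynomial (Fin 3) F)) :
    Subalgebra F (MvPolynomial (Fin 3) F) :=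
  Algebra.adjoin F {m | ∃ f ∈ S, f ≠ 0 ∧ m = monomial (grevlex.degree f) 1}

/-- `B` is a SAGBI basis for the algebra `A`: it is contained in `A`, and its lead monomials
generate the lead term algebra of `A`. -/
def IsSagbiBasis (B : Set (MvPolynomial (Fin 3) F)) (A : Subalgebra F (MvPolynomial (Fin 3) F)) :
    Prop :=
  B ⊆ A ∧ leadAlgebra B = leadAlgebra (A : Set (MvPolynomial (Fin 3) F))

/-- The product `h^I = ∏ i, h_i ^ I_i`. -/
noncomputable def hpow (h : Fin 4 → MvPolynomial (Fin 3) F) (I : Fin 4 →₀ ℕ) :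
    MvPolynomial (Fin 3) F :=
  ∏ i, h i ^ I i

/-- `SubductsToZero h f P`: some iteration of `f ↦ f - c * h^I`, where `LT(f) = LT(c * h^I)`,
leads from `f` to `0`, and `P` is the sum of the terms `c * T^I` that were used; so `f = P(h)`. -/
inductive SubductsToZero (h : Fin 4 → MvPolynomial (Fin 3) F) :
    MvPolynomial (Fin 3) F → MvPolynomial (Fin 4) F → Prop
  | zero : SubductsToZero h 0 0
  | step (f : MvPolynomial (Fin 3) F) (I : Fin 4 →₀ ℕ) (c : F) (P : MvPolynomial (Fin 4) F)
      (hf : f ≠ 0) (hlt : grevlex.leadingTerm f = grevlex.leadingTerm (C c * hpow h I))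
      (hP : SubductsToZero h (f - C c * hpow h I) P) :
      SubductsToZero h f (monomial I c + P)

/-- `A` is a hypersurface with homogeneous generators `h_i` of degrees `d_i`, and the ideal of
relations among the `h_i` is generated by one relation, of degree `r`, which is the relation that
comes from subducting the non-trivial tête-à-tête `(h^I, h^J)`. -/
structure IsHypersurface (A : Subalgebra F (MvPolynomial (Fin 3) F))
    (h : Fin 4 → MvPolynomial (Fin 3) F) (d : Fin 4 → ℕ) (I J : Fin 4 →₀ ℕ) (r : ℕ) : Prop where
  homogeneous : ∀ i, (h i).IsHomogeneous (d i)
  generates : Algebra.adjoin F (Set.range h) = A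
  teteATete : grevlex.degree (hpow h I) = grevlex.degree (hpow h J)
  nontrivial : Disjoint I.support J.support
  relation : ∃ c : F, grevlex.leadingTerm (hpow h I) = grevlex.leadingTerm (C c * hpow h J) ∧
    (∃ P, SubductsToZero h (hpow h I - C c * hpow h J) P) ∧
    ∀ P, SubductsToZero h (hpow h I - C c * hpow h J) P →
      monomial I 1 - monomial J c - P ≠ 0 ∧
      IsWeightedHomogeneous d (monomial I 1 - monomial J c - P) r ∧
      RingHom.ker (aeval h : MvPolynomial (Fin 4) F →ₐ[F] MvPolynomial (Fin 3) F) =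
        Ideal.span {monomial I 1 - monomial J c - P}

/-! ### The invariants `h₁` and `h₂` -/

/-- `δ = y² - xz`. -/
noncomputable def delta : MvPolynomial (Fin 3) F := X 1 ^ 2 - X 0 * X 2

/-- `h₁ = y^p + (γ₁₃₅₇/γ₁₂₅₇) δ x^(p-2) + (γ₂₃₅₇/γ₁₂₅₇) y x^(p-1)`. -/
noncomputable def h1 (p : ℕ) (M : Matrix (Fin 2) (Fin 4) F) : MvPolynomial (Fin 3) F :=
  X 1 ^ p + C (gamma p M 1 3 5 7 / gamma p M 1 2 5 7) * delta * X 0 ^ (p - 2)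
    + C (gamma p M 2 3 5 7 / gamma p M 1 2 5 7) * X 1 * X 0 ^ (p - 1)

/-- The subduction of `N_M(y)`, with `α = γ₁₃₅₇/γ₁₂₅₇`. -/
noncomputable def h2tilde (p : ℕ) [Fact p.Prime] [CharP F p] (M : Matrix (Fin 2) (Fin 4) F)
    (α : F) : MvPolynomial (Fin 3) F :=
  orbitNorm p M (X 1) - h1 p M ^ p ^ 3
    + C (α ^ p ^ 3) * h1 p M ^ (2 * p ^ 2) * X 0 ^ (p ^ 4 - 2 * p ^ 3)
    - C (2 * α ^ (p ^ 3 + p ^ 2)) * h1 p M ^ (p ^ 2 + 2 * p) * X 0 ^ (p ^ 4 - p ^ 3 - 2 * p ^ 2)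
    + C (4 * α ^ (p ^ 3 + p ^ 2 + p)) * h1 p M ^ (p ^ 2 + p + 2)
        * X 0 ^ (p ^ 4 - p ^ 3 - p ^ 2 - 2 * p)

/-- `h₂` is the quotient of `h2tilde` by `8 α^(p³+p²+p+1) x^(p⁴-p³-p²-p-2)`. -/
def IsH2 (p : ℕ) [Fact p.Prime] [CharP F p] (M : Matrix (Fin 2) (Fin 4) F)
    (h₂ : MvPolynomial (Fin 3) F) : Prop :=
  C (8 * (gamma p M 1 3 5 7 / gamma p M 1 2 5 7) ^ (p ^ 3 + p ^ 2 + p + 1))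
      * X 0 ^ (p ^ 4 - p ^ 3 - p ^ 2 - p - 2) * h₂
    = h2tilde p M (gamma p M 1 3 5 7 / gamma p M 1 2 5 7)

/-! ### Symmetric squares -/

/-- The action of `E` on `F[u, v]`, with `u = X 0` and `v = X 1`, for the two-dimensional
representation `W` given by `t`: the generator `e_j` fixes `u` and maps `v` to `v + t_j u`. -/
noncomputable def actTwo (p : ℕ) [CharP F p] (t : Fin 4 → F) (n : Fin 4 → ZMod p) :
    MvPolynomial (Fin 2) F →ₐ[F] MvPolynomial (Fin 2) F :=
  aeval ![X 0, X 1 + C (rowValue p t n) * X 0]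

/-- `V_M` is the symmetric square of the two-dimensional representation `W` given by `t`: an
`E`-equivariant algebra map `F[V_M] → F[W]` identifies the linear forms on `V_M` with the quadratic
forms on `W`. -/
def IsSymmetricSquareOf (p : ℕ) [CharP F p] (M : Matrix (Fin 2) (Fin 4) F) (t : Fin 4 → F) :
    Prop :=
  ∃ ψ : MvPolynomial (Fin 3) F →ₐ[F] MvPolynomial (Fin 2) F,
    (∀ n f, ψ (act p M n f) = actTwo p t n (ψ f)) ∧
    Set.BijOn ψ (homogeneousSubmodule (Fin 3) F 1) (homogeneousSubmodule (Fin 2) F 2)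

end Invariants

/-! ### Linear combinations of polynomials with distinct lead monomials -/

section LeadMonomials

variable {F : Type*} [Field F]

/-! Since γ₁₃₅₇ ≠ 0, every vector is a combination of the rows 1, 3, 5, 7 of Γ(M). The vanishing of
γ₁₂₃₅ and γ₁₂₃₄ leaves c₂ = A c₁ + B c₁^p with B = γ₁₂₅₇/γ₁₃₅₇ and A = γ₂₃₅₇/γ₁₃₅₇
(`exists_row_eq`); the two cases are B ≠ 0 and B = 0. Moreover the c₁ⱼ are independent over the
prime field (`rowValue_injective`), so the orbits of y and z have p⁴ elements.

The invariants are found by elimination of z. The leading coefficient in z of an invariant is a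
translation invariant in F[x][y], hence lies in F[x][N(y)] (`leadingCoeff_mem_adjoin`). Suppose
invariants eᵢ realise all z-degrees below p⁴ and g has z-degree p⁴, with leading coefficients that
become units when x is inverted. Division then puts some x^s f in the span of the products x^k eᵢ
N(y)^j g^l (`exists_X_zero_pow_mul_mem_span`). If also eᵢ is a form congruent to y^Dᵢ modulo x, with
the Dᵢ distinct modulo p⁴, and g has lead monomial z^(p⁴), these products have distinct lead
monomials; as x is the smallest variable, x^s can be cancelled (`mem_span_of_X_zero_mul_mem`). Every
invariant thus has the lead monomial of one of the products
(`exists_degree_eq_of_mem_invariantRing`).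

For B = 0 take eᵢ = δ'^i, with Dᵢ = 2i and p odd. For B ≠ 0 take h₁^a h₂^b with a < p³ and b < p:
the z-degree is a + p³b, and D = pa + nb with n = p³+p²+p+2 prime to p. That h₂ exists with lead
monomial y^n is a telescoping cancellation (`pow_dvd_subduction`).

When the generators have lead monomials x, y^d₁, y^d₂, z^q with d₁, d₂ coprime, the tête-à-tête
gives a relation monic in one variable T. Monomials of lower degree in T have distinct lead
monomials after substitution, so division by the relation leaves remainder zero for every relation
(`isHypersurface_of_degree`). -/

theorem degree_sum_smul {ι : Type*} {b : ι → MvPolynomial (Fin 3) F} {s : Finset ι} {c : ι → F}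
    (hs : s.Nonempty) (hb : ∀ i ∈ s, b i ≠ 0)
    (hinj : Set.InjOn (fun i => grevlex.degree (b i)) s) (hc : ∀ i ∈ s, c i ≠ 0) :
    ∑ i ∈ s, c i • b i ≠ 0 ∧
      ∃ i ∈ s, grevlex.degree (∑ i ∈ s, c i • b i) = grevlex.degree (b i) := by
  classical
  obtain ⟨i, hi, hmax⟩ := s.exists_max_image (fun i => grevlex.toSyn (grevlex.degree (b i))) hs
  have hne : coeff (grevlex.degree (b i)) (∑ i ∈ s, c i • b i) ≠ 0 := by
    rw [coeff_sum, Finset.sum_eq_single_of_mem i hi]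
    · rw [coeff_smul]
      exact mul_ne_zero (hc i hi) (grevlex.leadingCoeff_ne_zero_iff.2 (hb i hi))
    · intro j hj hji
      rw [coeff_smul, MonomialOrder.coeff_eq_zero_of_lt (m := grevlex), smul_zero]
      exact lt_of_le_of_ne (hmax j hj) fun h => hji (hinj hj hi (grevlex.toSyn.injective h))
  refine ⟨fun h => hne (by simp [h]), i, hi, grevlex.toSyn.injective (le_antisymm ?_ ?_)⟩
  · refine (MonomialOrder.degree_sum_le (m := grevlex)).trans (Finset.sup_le fun j hj => ?_)
    exact (grevlex.degree_smul_le).trans (hmax j hj)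
  · exact grevlex.le_degree (mem_support_iff.2 hne)

theorem degree_linearCombination {ι : Type*} {b : ι → MvPolynomial (Fin 3) F}
    (hb : ∀ i, b i ≠ 0) (hinj : Function.Injective fun i => grevlex.degree (b i))
    {c : ι →₀ F} (hc : c ≠ 0) :
    Finsupp.linearCombination F b c ≠ 0 ∧
      ∃ i ∈ c.support,
        grevlex.degree (Finsupp.linearCombination F b c) = grevlex.degree (b i) :=
  degree_sum_smul (Finsupp.support_nonempty_iff.2 hc) (fun i _ => hb i) hinj.injOn
    fun _ => Finsupp.mem_support_iff.1

theorem coeff_X_zero_mul_of_eq_zero {d : Fin 3 →₀ ℕ} (hd : d 0 = 0)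
    (f : MvPolynomial (Fin 3) F) : coeff d (X 0 * f) = 0 := by
  rw [coeff_X_mul', if_neg]
  simp [hd]

/-- Allows cancelling x inside a span. Split a combination equal to x f into the terms that are x
times another member of the family and the rest. The rest is divisible by x, yet its lead monomial
would be free of x, so it is empty. -/
theorem mem_span_of_X_zero_mul_mem {ι : Type*} {b : ι → MvPolynomial (Fin 3) F}
    (hb : ∀ i, b i ≠ 0) (hinj : Function.Injective fun i => grevlex.degree (b i))
    (hx : ∀ i, grevlex.degree (b i) 0 = 0 ∨ ∃ j, b i = X 0 * b j)
    {f : MvPolynomial (Fin 3) F} (hf : X 0 * f ∈ Submodule.span F (Set.range b)) :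
    f ∈ Submodule.span F (Set.range b) := by
  classical
  obtain ⟨c, hc⟩ := (Finsupp.mem_span_range_iff_exists_finsupp).1 hf
  rw [← Finsupp.linearCombination_apply] at hc
  set c₁ := c.filter fun i => ∃ j, b i = X 0 * b j with hc₁
  set c₂ := c.filter fun i => ¬ ∃ j, b i = X 0 * b j with hc₂
  have hsum : c₁ + c₂ = c := Finsupp.filter_add_filter_not _ _
  obtain ⟨g, hg, hg'⟩ : ∃ g ∈ Submodule.span F (Set.range b),
      Finsupp.linearCombination F b c₁ = X 0 * g := by
    have hmem : ∀ i ∈ c₁.support, ∃ j, b i = X 0 * b j := fun i hi => by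
      rw [hc₁, Finsupp.support_filter, Finset.mem_filter] at hi
      exact hi.2
    choose! j hj using hmem
    refine ⟨∑ i ∈ c₁.support, c₁ i • b (j i), Submodule.sum_mem _ fun i _ =>
      Submodule.smul_mem _ _ (Submodule.subset_span ⟨_, rfl⟩), ?_⟩
    rw [Finsupp.linearCombination_apply, Finsupp.sum, Finset.mul_sum]
    refine Finset.sum_congr rfl fun i hi => ?_
    rw [hj i hi, mul_smul_comm]
  have h₂ : c₂ = 0 := by
    by_contra hne
    obtain ⟨hne', i, hi, hdeg⟩ := degree_linearCombination hb hinj hne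
    have hi0 : grevlex.degree (b i) 0 = 0 := by
      rw [hc₂, Finsupp.support_filter, Finset.mem_filter] at hi
      exact (hx i).resolve_right hi.2
    have hlin : Finsupp.linearCombination F b c₂ = X 0 * (f - g) := by
      rw [mul_sub, ← hc, ← hg', ← map_sub, ← hsum, add_sub_cancel_left]
    apply hne'
    rw [← grevlex.coeff_degree_eq_zero_iff, hdeg, hlin]
    exact coeff_X_zero_mul_of_eq_zero hi0 _
  rw [h₂, add_zero] at hsum
  rw [hsum, hc] at hg'
  rwa [mul_left_cancel₀ (X_ne_zero 0) hg']

end LeadMonomials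

/-! ### Subduction and its consequences for generators -/

section Subduction

variable {F : Type*} [Field F] {h : Fin 4 → MvPolynomial (Fin 3) F}

theorem aeval_monomial_eq_hpow (I : Fin 4 →₀ ℕ) (c : F) :
    aeval h (monomial I c) = C c * hpow h I := by
  rw [aeval_monomial, algebraMap_eq, Finsupp.prod_fintype _ _ (by simp)]
  rfl

theorem hpow_single (i : Fin 4) (n : ℕ) : hpow h (Finsupp.single i n) = h i ^ n := by
  rw [hpow, Finset.prod_eq_single i] <;> simp +contextual [eq_comm]

theorem hpow_ne_zero (hh : ∀ i, h i ≠ 0) (I : Fin 4 →₀ ℕ) : hpow h I ≠ 0 :=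
  Finset.prod_ne_zero_iff.2 fun i _ => pow_ne_zero _ (hh i)

theorem degree_hpow (hh : ∀ i, h i ≠ 0) (I : Fin 4 →₀ ℕ) :
    grevlex.degree (hpow h I) = ∑ i, I i • grevlex.degree (h i) := by
  rw [hpow, grevlex.degree_prod fun i _ => pow_ne_zero _ (hh i)]
  simp_rw [grevlex.degree_pow]

theorem hpow_mem {A : Subalgebra F (MvPolynomial (Fin 3) F)} (hA : ∀ i, h i ∈ A)
    (I : Fin 4 →₀ ℕ) : hpow h I ∈ A :=
  prod_mem fun i _ => pow_mem (hA i) _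

theorem isHomogeneous_hpow {d : Fin 4 → ℕ} (hd : ∀ i, (h i).IsHomogeneous (d i))
    (I : Fin 4 →₀ ℕ) : (hpow h I).IsHomogeneous (Finsupp.weight d I) := by
  have := IsHomogeneous.prod Finset.univ (fun i => h i ^ I i) (fun i => d i * I i)
    fun i _ => (hd i).pow (I i)
  rw [Finsupp.weight_apply, Finsupp.sum_fintype _ _ (by simp)]
  simpa [hpow, mul_comm] using this

/-- A common lead term cancels in the difference. -/
theorem degree_sub_lt_of_leadingTerm_eq {f g : MvPolynomial (Fin 3) F}
    (hfg : grevlex.leadingTerm f = grevlex.leadingTerm g) (hne : f - g ≠ 0) :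
    grevlex.toSyn (grevlex.degree (f - g)) < grevlex.toSyn (grevlex.degree f) := by
  obtain ⟨hc, hd⟩ := MonomialOrder.leadingTerm_eq_leadingTerm_iff.1 hfg
  refine lt_of_le_of_ne ?_ fun heq => ?_
  · refine (grevlex.degree_sub_le).trans ?_
    rw [← hd, sup_idem]
  · apply grevlex.coeff_degree_ne_zero_iff.2 hne
    rw [grevlex.toSyn.injective heq, coeff_sub, sub_eq_zero]
    conv_rhs => rw [hd]
    exact hc

theorem leadingTerm_eq_C_mul {f g : MvPolynomial (Fin 3) F} (hg : g ≠ 0) (hf : f ≠ 0)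
    (hd : grevlex.degree f = grevlex.degree g) :
    grevlex.leadingTerm f =
      grevlex.leadingTerm (C (grevlex.leadingCoeff f / grevlex.leadingCoeff g) * g) := by
  have hg' := grevlex.leadingCoeff_ne_zero_iff.2 hg
  have hf' := grevlex.leadingCoeff_ne_zero_iff.2 hf
  rw [grevlex.leadingTerm_mul, MonomialOrder.leadingTerm_C, MonomialOrder.leadingTerm,
    MonomialOrder.leadingTerm, C_mul_monomial, hd, div_mul_cancel₀ _ hg']

theorem SubductsToZero.aeval_eq {f : MvPolynomial (Fin 3) F} {P : MvPolynomial (Fin 4) F}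
    (hP : SubductsToZero h f P) : aeval h P = f := by
  induction hP with
  | zero => simp
  | step f I c P hf hlt hP ih => rw [map_add, ih, aeval_monomial_eq_hpow]; ring

theorem SubductsToZero.eq_zero {P : MvPolynomial (Fin 4) F}
    (hP : SubductsToZero h 0 P) : P = 0 := by
  cases hP with
  | zero => rfl
  | step f I c P hf hlt hP => exact absurd rfl hf

/-- Lead monomials strictly decrease along a subduction, so the first term used has the largest one.
This later excludes the lead monomial of the tête-à-tête itself. -/
theorem SubductsToZero.degree_le {f : MvPolynomial (Fin 3) F} {P : MvPolynomial (Fin 4) F}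
    (hP : SubductsToZero h f P) {K : Fin 4 →₀ ℕ} (hK : K ∈ P.support) :
    grevlex.toSyn (grevlex.degree (hpow h K)) ≤ grevlex.toSyn (grevlex.degree f) := by
  classical
  induction hP with
  | zero => simp at hK
  | step f I c P hf hlt hP ih =>
    rcases Finset.mem_union.1 (support_add hK) with hK | hK
    · obtain rfl : K = I := by simpa using support_monomial_subset hK
      have hne : C c * hpow h K ≠ 0 := fun h0 => by
        rw [h0, MonomialOrder.leadingTerm_zero, MonomialOrder.leadingTerm_eq_zero_iff] at hlt
        exact hf hlt
      rw [(MonomialOrder.leadingTerm_eq_leadingTerm_iff.1 hlt).2,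
        grevlex.degree_mul (left_ne_zero_of_mul hne) (right_ne_zero_of_mul hne),
        MonomialOrder.degree_C, zero_add]
    · by_cases hne : f - C c * hpow h I = 0
      · rw [hne] at hP
        simp [hP.eq_zero] at hK
      · exact (ih hK).trans (degree_sub_lt_of_leadingTerm_eq hlt hne).le

theorem IsHomogeneous.degree_eq {f : MvPolynomial (Fin 3) F} {D : ℕ} (hf : f.IsHomogeneous D)
    (hne : f ≠ 0) : (grevlex.degree f).degree = D :=
  not_imp_comm.1 (hf.coeff_eq_zero) (grevlex.coeff_degree_ne_zero_iff.2 hne)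

theorem SubductsToZero.isWeightedHomogeneous {d : Fin 4 → ℕ}
    (hd : ∀ i, (h i).IsHomogeneous (d i)) {f : MvPolynomial (Fin 3) F}
    {P : MvPolynomial (Fin 4) F} (hP : SubductsToZero h f P) {D : ℕ} (hf : f.IsHomogeneous D) :
    IsWeightedHomogeneous d P D := by
  induction hP with
  | zero => exact isWeightedHomogeneous_zero _ _ _
  | step f I c P hne hlt hP ih =>
    have hne' : C c * hpow h I ≠ 0 := fun h0 => by
      rw [h0, MonomialOrder.leadingTerm_zero, MonomialOrder.leadingTerm_eq_zero_iff] at hlt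
      exact hne hlt
    have hI := (isHomogeneous_hpow hd I).C_mul c
    have hD : Finsupp.weight d I = D := by
      rw [← IsHomogeneous.degree_eq hI hne', ← IsHomogeneous.degree_eq hf hne,
        (MonomialOrder.leadingTerm_eq_leadingTerm_iff.1 hlt).2]
    refine (isWeightedHomogeneous_monomial _ _ _ hD).add (ih (hf.sub ?_))
    rwa [hD] at hI

/-- Each step lowers the lead monomial and stays in `A`; the monomial order is well founded. -/
theorem exists_subductsToZero {A : Subalgebra F (MvPolynomial (Fin 3) F)}
    (hh : ∀ i, h i ≠ 0) (hA : ∀ i, h i ∈ A)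
    (hLM : ∀ f ∈ A, f ≠ 0 → ∃ K, grevlex.degree f = grevlex.degree (hpow h K))
    (f : MvPolynomial (Fin 3) F) (hf : f ∈ A) : ∃ P, SubductsToZero h f P := by
  induction hs : grevlex.toSyn (grevlex.degree f) using WellFoundedLT.induction generalizing f with
  | ind s ih =>
    by_cases h0 : f = 0
    · exact ⟨0, h0 ▸ SubductsToZero.zero⟩
    obtain ⟨K, hK⟩ := hLM f hf h0
    have hlt := leadingTerm_eq_C_mul (hpow_ne_zero hh K) h0 hK
    set c := grevlex.leadingCoeff f / grevlex.leadingCoeff (hpow h K)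
    suffices ∃ P, SubductsToZero h (f - C c * hpow h K) P by
      obtain ⟨P, hP⟩ := this
      exact ⟨_, SubductsToZero.step f K c P h0 hlt hP⟩
    by_cases h1 : f - C c * hpow h K = 0
    · exact ⟨0, h1 ▸ SubductsToZero.zero⟩
    refine ih _ (hs ▸ degree_sub_lt_of_leadingTerm_eq hlt h1) _ ?_ rfl
    exact A.sub_mem hf (A.mul_mem (A.algebraMap_mem c) (hpow_mem hA K))

theorem isSagbiBasis_range {A : Subalgebra F (MvPolynomial (Fin 3) F)}
    (hh : ∀ i, h i ≠ 0) (hA : ∀ i, h i ∈ A)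
    (hLM : ∀ f ∈ A, f ≠ 0 → ∃ K, grevlex.degree f = grevlex.degree (hpow h K)) :
    IsSagbiBasis (Set.range h) A := by
  have hsub : Set.range h ⊆ A := by rintro _ ⟨i, rfl⟩; exact hA i
  refine ⟨hsub, le_antisymm (Algebra.adjoin_mono ?_) (Algebra.adjoin_le ?_)⟩
  · rintro m ⟨f, hf, h0⟩
    exact ⟨f, hsub hf, h0⟩
  · rintro m ⟨f, hf, h0, rfl⟩
    obtain ⟨K, hK⟩ := hLM f hf h0
    rw [hK, degree_hpow hh]
    have : monomial (∑ i, K i • grevlex.degree (h i)) (1 : F) =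
        ∏ i, monomial (grevlex.degree (h i)) (1 : F) ^ K i := by
      simp_rw [monomial_pow, one_pow]
      exact monomial_sum_one _ _
    rw [this]
    refine prod_mem fun i _ => pow_mem (Algebra.subset_adjoin ?_) _
    exact ⟨h i, ⟨i, rfl⟩, hh i, rfl⟩

theorem adjoin_range_eq {A : Subalgebra F (MvPolynomial (Fin 3) F)}
    (hh : ∀ i, h i ≠ 0) (hA : ∀ i, h i ∈ A)
    (hLM : ∀ f ∈ A, f ≠ 0 → ∃ K, grevlex.degree f = grevlex.degree (hpow h K)) :
    Algebra.adjoin F (Set.range h) = A := by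
  refine le_antisymm (Algebra.adjoin_le (by rintro _ ⟨i, rfl⟩; exact hA i)) fun f hf => ?_
  obtain ⟨P, hP⟩ := exists_subductsToZero hh hA hLM f hf
  rw [Algebra.adjoin_range_eq_range_aeval]
  exact ⟨P, hP.aeval_eq⟩

end Subduction

/-! ### The ideal of relations -/

section Relations

variable {F : Type*} [Field F]

/-- Division with remainder by a polynomial that is monic in one of the variables. -/
theorem exists_mul_add_of_monic {σ : Type*} (i : σ) (a : ℕ)
    {Q : MvPolynomial σ F} (hQ : ∀ K ∈ Q.support, K i < a) (f : MvPolynomial σ F) :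
    ∃ g r : MvPolynomial σ F, f = g * (monomial (Finsupp.single i a) 1 - Q) + r ∧
      ∀ K ∈ r.support, K i < a := by
  classical
  have hadd : ∀ f₁ f₂ : MvPolynomial σ F,
      (∃ g r, f₁ = g * (monomial (Finsupp.single i a) 1 - Q) + r ∧ ∀ K ∈ r.support, K i < a) →
      (∃ g r, f₂ = g * (monomial (Finsupp.single i a) 1 - Q) + r ∧ ∀ K ∈ r.support, K i < a) →
      ∃ g r, f₁ + f₂ = g * (monomial (Finsupp.single i a) 1 - Q) + r ∧
        ∀ K ∈ r.support, K i < a := by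
    rintro f₁ f₂ ⟨g₁, r₁, rfl, h₁⟩ ⟨g₂, r₂, rfl, h₂⟩
    refine ⟨g₁ + g₂, r₁ + r₂, by ring, fun K hK => ?_⟩
    rcases Finset.mem_union.1 (support_add hK) with hK | hK
    exacts [h₁ K hK, h₂ K hK]
  have hmon : ∀ (k : ℕ) (K : σ →₀ ℕ) (c : F), K i = k →
      ∃ g r, monomial K c = g * (monomial (Finsupp.single i a) 1 - Q) + r ∧
        ∀ K ∈ r.support, K i < a := by
    intro k
    induction k using Nat.strong_induction_on with
    | _ k ih =>
      intro K c hk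
      by_cases hlt : K i < a
      · refine ⟨0, monomial K c, by ring, fun L hL => ?_⟩
        obtain rfl : L = K := by simpa using support_monomial_subset hL
        exact hlt
      have hle : Finsupp.single i a ≤ K := by
        rw [Finsupp.single_le_iff]; omega
      -- Replacing one factor T_i^a by Q lowers the exponent of T_i in every resulting monomial, so
      -- the strong induction applies.
      have hsplit : monomial K c = monomial (K - Finsupp.single i a) c *
          (monomial (Finsupp.single i a) 1 - Q) + monomial (K - Finsupp.single i a) c * Q := by
        rw [mul_sub, monomial_mul, tsub_add_cancel_of_le hle, mul_one, sub_add_cancel]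
      have hrest : ∀ S : Finset (σ →₀ ℕ), S ⊆ Q.support →
          ∃ g r, monomial (K - Finsupp.single i a) c * ∑ L ∈ S, monomial L (coeff L Q) =
            g * (monomial (Finsupp.single i a) 1 - Q) + r ∧ ∀ K ∈ r.support, K i < a := by
        intro S
        induction S using Finset.induction_on with
        | empty => exact fun _ => ⟨0, 0, by simp, by simp⟩
        | insert L S hL ihS =>
          intro hS
          rw [Finset.sum_insert hL, mul_add, monomial_mul]
          refine hadd _ _ (ih (K i - a + L i) ?_ _ _ ?_)
            (ihS fun L' hL' => hS (Finset.mem_insert_of_mem hL'))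
          · have := hQ L (hS (Finset.mem_insert_self _ _)); omega
          · simp
      obtain ⟨g, r, hgr, hr⟩ := hrest Q.support subset_rfl
      rw [support_sum_monomial_coeff] at hgr
      refine ⟨monomial (K - Finsupp.single i a) c + g, r, ?_, hr⟩
      rw [hsplit, hgr]; ring
  induction f using MvPolynomial.monomial_add_induction_on with
  | C c => exact hmon _ 0 c rfl
  | monomial_add K c f _ _ ihf => exact hadd _ _ (hmon _ K c rfl) ihf

variable {h : Fin 4 → MvPolynomial (Fin 3) F}

/-- Modulo the relation, which is monic in T_i, a polynomial reduces to T_i-degree below a. By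
`hinj` the monomials left have images with distinct lead monomials, so a remainder in the kernel is
zero. -/
theorem ker_aeval_eq_span (hh : ∀ i, h i ≠ 0) (i : Fin 4) (a : ℕ) {Q : MvPolynomial (Fin 4) F}
    (hQ : ∀ K ∈ Q.support, K i < a)
    (hinj : ∀ K L : Fin 4 →₀ ℕ, K i < a → L i < a →
      grevlex.degree (hpow h K) = grevlex.degree (hpow h L) → K = L)
    (hrel : aeval h (monomial (Finsupp.single i a) 1 - Q) = 0) :
    RingHom.ker (aeval h : MvPolynomial (Fin 4) F →ₐ[F] MvPolynomial (Fin 3) F) =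
      Ideal.span {monomial (Finsupp.single i a) 1 - Q} := by
  classical
  refine le_antisymm (fun f hf => ?_) ?_
  · obtain ⟨g, r, rfl, hr⟩ := exists_mul_add_of_monic i a hQ f
    rw [RingHom.mem_ker, map_add, map_mul, hrel, mul_zero, zero_add] at hf
    suffices r = 0 by
      rw [this, add_zero]
      exact Ideal.mul_mem_left _ _ (Ideal.subset_span rfl)
    by_contra hne
    have hsum : ∑ K ∈ r.support, coeff K r • hpow h K = 0 := by
      rw [← hf]
      conv_rhs => rw [← support_sum_monomial_coeff r, map_sum]
      simp_rw [aeval_monomial_eq_hpow, smul_eq_C_mul]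
    exact (degree_sum_smul (support_nonempty.2 hne) (fun K _ => hpow_ne_zero hh K)
      (fun K hK L hL hKL => hinj K L (hr K hK) (hr L hL) hKL)
      fun K => mem_support_iff.1).1 hsum
  · rw [Ideal.span_le, Set.singleton_subset_iff]
    exact hrel

theorem eq_of_mul_add_mul_eq {a b k l k' l' : ℕ} (hab : Nat.Coprime a b) (hk : k < a)
    (hk' : k' < a) (h : b * k + a * l = b * k' + a * l') : k = k' ∧ l = l' := by
  have hmod : b * k ≡ b * k' [MOD a] := by
    have := congrArg (· % a) h
    simpa [Nat.ModEq, Nat.add_mul_mod_self_left] using this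
  have hkk : k = k' := Nat.ModEq.eq_of_lt_of_lt (Nat.ModEq.cancel_left_of_coprime hab hmod) hk hk'
  subst hkk
  exact ⟨rfl, Nat.eq_of_mul_eq_mul_left (by omega) (Nat.add_left_cancel h)⟩

/-- Generators with lead monomials `x, y ^ d₁, y ^ d₂, z ^ q`, where `d₁` and `d₂` are coprime,
whose lead monomials generate the lead monomials of `A`. -/
theorem isHypersurface_of_degree {A : Subalgebra F (MvPolynomial (Fin 3) F)} {d : Fin 4 → ℕ}
    (hh : ∀ i, h i ≠ 0) (hA : ∀ i, h i ∈ A)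
    (hLM : ∀ f ∈ A, f ≠ 0 → ∃ K, grevlex.degree f = grevlex.degree (hpow h K))
    (hd : ∀ i, (h i).IsHomogeneous (d i))
    (h0 : grevlex.degree (h 0) = Finsupp.single 0 (d 0))
    (h1 : grevlex.degree (h 1) = Finsupp.single 1 (d 1))
    (h2 : grevlex.degree (h 2) = Finsupp.single 1 (d 2))
    (h3 : grevlex.degree (h 3) = Finsupp.single 2 (d 3))
    (hpos : ∀ i, 0 < d i) {i j : Fin 4} (hij : (i = 1 ∧ j = 2) ∨ (i = 2 ∧ j = 1))
    (hcop : Nat.Coprime (d j) (d i)) :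
    IsHypersurface A h d (Finsupp.single i (d j)) (Finsupp.single j (d i)) (d j * d i) := by
  classical
  have hne : i ≠ j := by rcases hij with ⟨rfl, rfl⟩ | ⟨rfl, rfl⟩ <;> decide
  have hi : grevlex.degree (h i) = Finsupp.single 1 (d i) := by
    rcases hij with ⟨rfl, rfl⟩ | ⟨rfl, rfl⟩ <;> assumption
  have hj : grevlex.degree (h j) = Finsupp.single 1 (d j) := by
    rcases hij with ⟨rfl, rfl⟩ | ⟨rfl, rfl⟩ <;> assumption
  have hdegI : grevlex.degree (hpow h (Finsupp.single i (d j))) = Finsupp.single 1 (d j * d i) := by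
    rw [hpow_single, grevlex.degree_pow, hi]; simp
  have hdegJ : grevlex.degree (hpow h (Finsupp.single j (d i))) = Finsupp.single 1 (d j * d i) := by
    rw [hpow_single, grevlex.degree_pow, hj]; simp [mul_comm]
  have hdeg : ∀ K : Fin 4 →₀ ℕ, grevlex.degree (hpow h K) 0 = d 0 * K 0 ∧
      grevlex.degree (hpow h K) 1 = d i * K i + d j * K j ∧
      grevlex.degree (hpow h K) 2 = d 3 * K 3 := by
    intro K
    rw [degree_hpow hh]
    simp only [Fin.sum_univ_four, h0, h1, h2, h3]
    rcases hij with ⟨rfl, rfl⟩ | ⟨rfl, rfl⟩ <;> simp [mul_comm, add_comm]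
  have hweight : ∀ K : Fin 4 →₀ ℕ,
      Finsupp.weight d K = d 0 * K 0 + (d i * K i + d j * K j) + d 3 * K 3 := by
    intro K
    rw [Finsupp.weight_apply, Finsupp.sum_fintype _ _ (by simp), Fin.sum_univ_four]
    rcases hij with ⟨rfl, rfl⟩ | ⟨rfl, rfl⟩ <;> simp [mul_comm] <;> ring
  have hinj : ∀ K L : Fin 4 →₀ ℕ, K i < d j → L i < d j →
      grevlex.degree (hpow h K) = grevlex.degree (hpow h L) → K = L := by
    intro K L hK hL hKL
    have e0 := DFunLike.congr_fun hKL 0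
    have e1 := DFunLike.congr_fun hKL 1
    have e2 := DFunLike.congr_fun hKL 2
    rw [(hdeg K).1, (hdeg L).1] at e0
    rw [(hdeg K).2.1, (hdeg L).2.1] at e1
    rw [(hdeg K).2.2, (hdeg L).2.2] at e2
    have f0 := Nat.eq_of_mul_eq_mul_left (hpos 0) e0
    have f3 := Nat.eq_of_mul_eq_mul_left (hpos 3) e2
    obtain ⟨fi, fj⟩ := eq_of_mul_add_mul_eq hcop hK hL e1
    ext k
    rcases hij with ⟨rfl, rfl⟩ | ⟨rfl, rfl⟩ <;> fin_cases k <;> assumption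
  refine ⟨hd, adjoin_range_eq hh hA hLM, by rw [hdegI, hdegJ], ?_, ?_⟩
  · rw [Finsupp.support_single _ (hpos j).ne', Finsupp.support_single _ (hpos i).ne']
    simpa using hne
  set c := grevlex.leadingCoeff (hpow h (Finsupp.single i (d j))) /
    grevlex.leadingCoeff (hpow h (Finsupp.single j (d i))) with hc
  have hlt := leadingTerm_eq_C_mul (hpow_ne_zero hh _) (hpow_ne_zero hh _) (hdegI.trans hdegJ.symm)
  refine ⟨c, hlt, exists_subductsToZero hh hA hLM _ (A.sub_mem (hpow_mem hA _)
    (A.mul_mem (A.algebraMap_mem c) (hpow_mem hA _))), fun P hP => ?_⟩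
  have hwI : Finsupp.weight d (Finsupp.single i (d j)) = d j * d i := by
    simp [Finsupp.weight_apply]
  have hwJ : Finsupp.weight d (Finsupp.single j (d i)) = d j * d i := by
    simp [Finsupp.weight_apply, mul_comm]
  have hhomI := isHomogeneous_hpow hd (Finsupp.single i (d j))
  have hhomJ := (isHomogeneous_hpow hd (Finsupp.single j (d i))).C_mul c
  rw [hwI] at hhomI
  rw [hwJ] at hhomJ
  have hPhom : IsWeightedHomogeneous d P (d j * d i) :=
    hP.isWeightedHomogeneous hd (hhomI.sub hhomJ)
  -- A monomial of P with T_i-exponent at least d_j already uses the whole weight d_j d_i on T_i. It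
  -- would have the lead monomial of h^I, but the terms of the subduction lie strictly below it.
  have hPlt : ∀ K ∈ P.support, K i < d j := by
    intro K hK
    by_contra hge
    have hw := hPhom (mem_support_iff.1 hK)
    rw [hweight] at hw
    have hge' : d i * d j ≤ d i * K i := Nat.mul_le_mul_left _ (not_lt.1 hge)
    rw [mul_comm (d j) (d i)] at hw
    obtain ⟨g0, g1, g2⟩ := hdeg K
    have hdegK : grevlex.degree (hpow h K) = grevlex.degree (hpow h (Finsupp.single i (d j))) := by
      rw [hdegI, mul_comm]
      ext k
      fin_cases k
      · rw [Finsupp.single_eq_of_ne (by decide)]; simp only [Fin.zero_eta]; omega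
      · simp only [Fin.mk_one, Finsupp.single_eq_same]; omega
      · rw [Finsupp.single_eq_of_ne (by decide)]; simp only [Fin.reduceFinMk]; omega
    have hle := hP.degree_le hK
    by_cases hz : hpow h (Finsupp.single i (d j)) - C c * hpow h (Finsupp.single j (d i)) = 0
    · rw [hz] at hP
      simp [hP.eq_zero] at hK
    · rw [hdegK] at hle
      exact absurd (degree_sub_lt_of_leadingTerm_eq hlt hz) (not_lt.2 hle)
  have hQ : ∀ K ∈ (monomial (Finsupp.single j (d i)) c + P).support, K i < d j := by
    intro K hK
    rcases Finset.mem_union.1 (support_add hK) with hK | hK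
    · obtain rfl : K = _ := by simpa using support_monomial_subset hK
      simpa [Finsupp.single_apply, hne.symm] using hpos j
    · exact hPlt K hK
  rw [sub_sub]
  refine ⟨fun h0 => ?_, ?_, ker_aeval_eq_span hh i (d j) hQ hinj ?_⟩
  · have hcoef := congrArg (coeff (Finsupp.single i (d j))) (sub_eq_zero.1 h0)
    rw [coeff_monomial, if_pos rfl] at hcoef
    have := hQ (Finsupp.single i (d j)) (mem_support_iff.2 (by rw [← hcoef]; exact one_ne_zero))
    simp at this
  · exact (isWeightedHomogeneous_monomial _ _ _ hwI).sub
      ((isWeightedHomogeneous_monomial _ _ _ hwJ).add hPhom)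
  · rw [map_sub, map_add, aeval_monomial_eq_hpow, aeval_monomial_eq_hpow, hP.aeval_eq]
    simp

end Relations

/-! ### The group action and orbit products -/

section Action

variable {F : Type*} [Field F] (p : ℕ) [CharP F p] (M : Matrix (Fin 2) (Fin 4) F)

theorem rowValue_add (c : Fin 4 → F) (m n : Fin 4 → ZMod p) :
    rowValue p c (m + n) = rowValue p c m + rowValue p c n := by
  simp [rowValue, add_mul, Finset.sum_add_distrib]

theorem act_X_zero (n : Fin 4 → ZMod p) : act p M n (X 0) = X 0 := by
  simp [act, sigmaMat, Fin.sum_univ_three]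

theorem act_X_one (n : Fin 4 → ZMod p) :
    act p M n (X 1) = X 1 + C (rowValue p (M 0) n) * X 0 := by
  simp [act, sigmaMat, Fin.sum_univ_three, add_comm]

theorem act_X_two (n : Fin 4 → ZMod p) :
    act p M n (X 2) = X 2 + C (2 * rowValue p (M 0) n) * X 1 +
      C (rowValue p (M 0) n ^ 2 + rowValue p (M 1) n) * X 0 := by
  simp [act, sigmaMat, Fin.sum_univ_three]
  ring

theorem act_C (n : Fin 4 → ZMod p) (c : F) : act p M n (C c) = C c :=
  (act p M n).commutes c

theorem act_act (m n : Fin 4 → ZMod p) (f : MvPolynomial (Fin 3) F) :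
    act p M m (act p M n f) = act p M (m + n) f := by
  suffices (act p M m).comp (act p M n) = act p M (m + n) from DFunLike.congr_fun this f
  refine MvPolynomial.algHom_ext fun i => ?_
  rw [AlgHom.comp_apply]
  fin_cases i
  · simp only [Fin.zero_eta, act_X_zero]
  · simp only [Fin.mk_one, act_X_one, map_add, map_mul, act_X_zero, act_C, rowValue_add]
    ring
  · simp only [Fin.reduceFinMk, act_X_two, map_add, map_mul, act_X_one, act_X_zero, act_C,
      rowValue_add, map_pow, map_ofNat]
    ring

theorem X_zero_mem_invariantRing : X 0 ∈ invariantRing p M := act_X_zero p M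

variable {p M}

theorem mem_invariantRing_of_mul_mem {f g : MvPolynomial (Fin 3) F} (hg : g ≠ 0)
    (hgA : g ∈ invariantRing p M) (h : g * f ∈ invariantRing p M) : f ∈ invariantRing p M := by
  intro n
  have := h n
  rw [map_mul, hgA n] at this
  exact mul_left_cancel₀ hg this

theorem act_X_one_injective (hinj : Function.Injective (rowValue p (M 0))) :
    Function.Injective fun n => act p M n (X 1) := by
  intro m n h
  -- Evaluation at this point reads off the coefficient of x.
  have := congrArg (eval ![1, 0, 0]) h
  simp only [act_X_one, map_add, map_mul, eval_X, eval_C] at this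
  exact hinj (by simpa using this)

/-- The parameter a serves both cases: a = 0 gives z, and the ratio of the two rows gives z'. -/
theorem act_X_two_sub (a : F) (n : Fin 4 → ZMod p) :
    act p M n (X 2 - C a * X 1) = X 2 + C (2 * rowValue p (M 0) n - a) * X 1 +
      C (rowValue p (M 0) n ^ 2 + rowValue p (M 1) n - a * rowValue p (M 0) n) * X 0 := by
  simp only [map_sub, map_mul, act_X_two, act_X_one, act_C, map_add, map_pow, map_ofNat]
  ring

theorem act_X_two_sub_injective (h2 : (2 : F) ≠ 0)
    (hinj : Function.Injective (rowValue p (M 0))) (a : F) :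
    Function.Injective fun n => act p M n (X 2 - C a * X 1) := by
  intro m n h
  -- The coefficient of y is 2c₁ - a, which determines c₁ because 2 is invertible.
  have := congrArg (eval ![0, 1, 0]) h
  simp only [act_X_two_sub, map_add, map_mul, eval_X, eval_C] at this
  exact hinj (by simpa [h2] using this)

theorem rowValue_linear (A B : F) (c d : Fin 4 → F) (n : Fin 4 → ZMod p) :
    rowValue p (fun j => A * c j + B * d j) n = A * rowValue p c n + B * rowValue p d n := by
  simp only [rowValue, Finset.mul_sum, ← Finset.sum_add_distrib]
  exact Finset.sum_congr rfl fun j _ => by ring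

variable (F) in
theorem two_ne_zero_of_lt (hp : 2 < p) : (2 : F) ≠ 0 := by
  intro h
  have := (CharP.cast_eq_zero_iff F p 2).1 (by exact_mod_cast h)
  exact absurd (Nat.le_of_dvd two_pos this) (not_le.2 hp)

variable [Fact p.Prime]

theorem prod_act_mem_invariantRing (f : MvPolynomial (Fin 3) F) :
    ∏ n, act p M n f ∈ invariantRing p M := by
  intro m
  rw [map_prod]
  simp_rw [act_act]
  exact Fintype.prod_equiv (Equiv.addLeft m) _ _ fun _ => rfl

/-- The norm runs over the orbit as a set; a trivial stabilizer turns it into a product over the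
group. -/
theorem orbitNorm_eq_prod {f : MvPolynomial (Fin 3) F}
    (hf : Function.Injective fun n => act p M n f) : orbitNorm p M f = ∏ n, act p M n f := by
  classical
  rw [orbitNorm]
  convert Finset.prod_image (s := Finset.univ) (f := fun g => g) hf.injOn

theorem card_group : Fintype.card (Fin 4 → ZMod p) = p ^ 4 := by
  simp [ZMod.card]

end Action

/-! ### Forms with lead monomial a power of y or equal to z -/

section PurePowers

variable {F : Type*} [Field F]

theorem degree_eq_of_mem_support {d : Fin 3 →₀ ℕ} {f : MvPolynomial (Fin 3) F}
    (hd : coeff d f ≠ 0)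
    (hle : ∀ m ∈ f.support, grevlex.toSyn m ≤ grevlex.toSyn d) : grevlex.degree f = d :=
  grevlex.toSyn.injective (le_antisymm (grevlex.degree_le_iff.2 hle)
    (grevlex.le_degree (mem_support_iff.2 hd)))

theorem MvPolynomial.IsHomogeneous.sum_exponents {f : MvPolynomial (Fin 3) F} {n : ℕ}
    (hf : f.IsHomogeneous n) {m : Fin 3 →₀ ℕ} (hm : m ∈ f.support) : m 0 + m 1 + m 2 = n := by
  rw [← not_imp_comm.1 hf.coeff_eq_zero (mem_support_iff.1 hm), Finsupp.degree_eq_sum,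
    Fin.sum_univ_three]

/-- `f` is a form of degree `n` that is congruent to `y ^ n` modulo `x`. -/
def IsYPower (f : MvPolynomial (Fin 3) F) (n : ℕ) : Prop :=
  f.IsHomogeneous n ∧ X 0 ∣ f - X 1 ^ n

theorem IsYPower.mul {f g : MvPolynomial (Fin 3) F} {m n : ℕ} (hf : IsYPower f m)
    (hg : IsYPower g n) : IsYPower (f * g) (m + n) := by
  refine ⟨hf.1.mul hg.1, ?_⟩
  obtain ⟨u, hu⟩ := hf.2
  obtain ⟨v, hv⟩ := hg.2
  refine ⟨u * g + X 1 ^ m * v, ?_⟩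
  rw [mul_add, ← mul_assoc, ← hu, mul_left_comm, ← hv]
  ring

theorem isYPower_one : IsYPower (1 : MvPolynomial (Fin 3) F) 0 :=
  ⟨isHomogeneous_one _ _, by simp⟩

theorem IsYPower.pow {f : MvPolynomial (Fin 3) F} {m : ℕ} (hf : IsYPower f m) (k : ℕ) :
    IsYPower (f ^ k) (m * k) := by
  induction k with
  | zero => simpa using isYPower_one
  | succ k ih => rw [pow_succ]; exact ih.mul hf

theorem isYPower_prod {ι : Type*} {s : Finset ι} {f : ι → MvPolynomial (Fin 3) F}
    (hf : ∀ i ∈ s, IsYPower (f i) 1) : IsYPower (∏ i ∈ s, f i) s.card := by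
  classical
  induction s using Finset.induction_on with
  | empty => simpa using isYPower_one
  | insert i s hi ih =>
    rw [Finset.prod_insert hi, Finset.card_insert_of_notMem hi, add_comm]
    exact (hf i (Finset.mem_insert_self _ _)).mul
      (ih fun j hj => hf j (Finset.mem_insert_of_mem hj))

/-- Among monomials of degree n, those containing x lie below y^n, and y^n is the only monomial of f
free of x. -/
theorem IsYPower.degree_eq {f : MvPolynomial (Fin 3) F} {n : ℕ} (hf : IsYPower f n) :
    f ≠ 0 ∧ grevlex.degree f = Finsupp.single 1 n := by
  obtain ⟨g, hg⟩ := hf.2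
  rw [sub_eq_iff_eq_add'] at hg
  have hcoeff : coeff (Finsupp.single 1 n) f ≠ 0 := by
    rw [hg, coeff_add, coeff_X_zero_mul_of_eq_zero (by simp), add_zero, coeff_X_pow, if_pos rfl]
    exact one_ne_zero
  refine ⟨fun h => hcoeff (by simp [h]), degree_eq_of_mem_support hcoeff fun m hm => ?_⟩
  rw [← not_lt, grevlex_lt_iff]
  have hdeg := hf.1.sum_exponents hm
  by_cases hmn : m = Finsupp.single 1 n
  · subst hmn; simp
  have h0 : m 0 ≠ 0 := by
    intro h0
    rw [mem_support_iff, hg, coeff_add, coeff_X_zero_mul_of_eq_zero h0, add_zero, coeff_X_pow,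
      if_neg (Ne.symm hmn)] at hm
    exact hm rfl
  simp
  omega

theorem isYPower_X_one_add (c : F) :
    IsYPower (X 1 + C c * X 0 : MvPolynomial (Fin 3) F) 1 :=
  ⟨(isHomogeneous_X _ _).add (isHomogeneous_C_mul_X _ _), ⟨C c, by ring⟩⟩

theorem degree_X_two_add (a b : F) :
    (X 2 + C a * X 1 + C b * X 0 : MvPolynomial (Fin 3) F) ≠ 0 ∧
    grevlex.degree (X 2 + C a * X 1 + C b * X 0 : MvPolynomial (Fin 3) F) =
      Finsupp.single 2 1 := by
  have hcoeff : coeff (Finsupp.single 2 1) (X 2 + C a * X 1 + C b * X 0 :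
      MvPolynomial (Fin 3) F) ≠ 0 := by
    simp [coeff_C_mul, coeff_X, Finsupp.single_left_inj]
  refine ⟨fun h => hcoeff (by simp [h]), degree_eq_of_mem_support hcoeff fun m hm => ?_⟩
  have hhom : (X 2 + C a * X 1 + C b * X 0 : MvPolynomial (Fin 3) F).IsHomogeneous 1 :=
    ((isHomogeneous_X _ _).add (isHomogeneous_C_mul_X _ _)).add (isHomogeneous_C_mul_X _ _)
  have hdeg := hhom.sum_exponents hm
  rw [← not_lt, grevlex_lt_iff]
  simp
  omega

end PurePowers

/-! ### The norms of y and z - ay -/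

section Norms

variable {F : Type*} [Field F] {p : ℕ} [CharP F p] [Fact p.Prime]
  {M : Matrix (Fin 2) (Fin 4) F}

theorem orbitNorm_X_one (hinj : Function.Injective (rowValue p (M 0))) :
    orbitNorm p M (X 1) = ∏ n, (X 1 + C (rowValue p (M 0) n) * X 0) := by
  rw [orbitNorm_eq_prod (act_X_one_injective hinj)]
  simp_rw [act_X_one]

theorem isYPower_orbitNorm_X_one (hinj : Function.Injective (rowValue p (M 0))) :
    IsYPower (orbitNorm p M (X 1)) (p ^ 4) := by
  rw [orbitNorm_X_one hinj, ← card_group (p := p)]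
  exact isYPower_prod fun n _ => isYPower_X_one_add _

theorem orbitNorm_X_one_mem (hinj : Function.Injective (rowValue p (M 0))) :
    orbitNorm p M (X 1) ∈ invariantRing p M := by
  rw [orbitNorm_eq_prod (act_X_one_injective hinj)]
  exact prod_act_mem_invariantRing _

theorem orbitNorm_X_two_sub_mem (h2 : (2 : F) ≠ 0)
    (hinj : Function.Injective (rowValue p (M 0))) (a : F) :
    orbitNorm p M (X 2 - C a * X 1) ∈ invariantRing p M := by
  rw [orbitNorm_eq_prod (act_X_two_sub_injective h2 hinj a)]
  exact prod_act_mem_invariantRing _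

theorem isHomogeneous_orbitNorm_X_two_sub (h2 : (2 : F) ≠ 0)
    (hinj : Function.Injective (rowValue p (M 0))) (a : F) :
    (orbitNorm p M (X 2 - C a * X 1)).IsHomogeneous (p ^ 4) := by
  rw [orbitNorm_eq_prod (act_X_two_sub_injective h2 hinj a)]
  simp_rw [act_X_two_sub]
  have := IsHomogeneous.prod Finset.univ (fun n : Fin 4 → ZMod p => (X 2 +
    C (2 * rowValue p (M 0) n - a) * X 1 +
    C (rowValue p (M 0) n ^ 2 + rowValue p (M 1) n - a * rowValue p (M 0) n) * X 0 :
      MvPolynomial (Fin 3) F)) (fun _ => 1) fun n _ =>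
    ((isHomogeneous_X _ _).add (isHomogeneous_C_mul_X _ _)).add (isHomogeneous_C_mul_X _ _)
  simpa only [Finset.sum_const, Finset.card_univ, card_group, smul_eq_mul, mul_one] using this

theorem degree_orbitNorm_X_two_sub (h2 : (2 : F) ≠ 0)
    (hinj : Function.Injective (rowValue p (M 0))) (a : F) :
    orbitNorm p M (X 2 - C a * X 1) ≠ 0 ∧
      grevlex.degree (orbitNorm p M (X 2 - C a * X 1)) = Finsupp.single 2 (p ^ 4) := by
  rw [orbitNorm_eq_prod (act_X_two_sub_injective h2 hinj a)]
  simp_rw [act_X_two_sub]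
  refine ⟨Finset.prod_ne_zero_iff.2 fun n _ => (degree_X_two_add _ _).1, ?_⟩
  rw [grevlex.degree_prod fun n _ => (degree_X_two_add _ _).1]
  simp_rw [(degree_X_two_add _ _).2]
  rw [Finset.sum_const, Finset.card_univ, card_group]
  simp

end Norms

/-! ### Invariants of a finite set of translations -/

section TaylorInvariants

/-- Polynomials that are invariant under translation by `v i` for all `i` are polynomials in a monic
invariant whose degree is the number of translations. -/
theorem mem_adjoin_of_taylor_eq {S ι : Type*} [CommRing S] [IsDomain S] [Fintype ι] [Nonempty ι]
    {v : ι → S} (hv : Function.Injective v) {N : Polynomial S} (hN : N.Monic)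
    (hcard : N.natDegree = Fintype.card ι) (hNv : ∀ i, Polynomial.taylor (v i) N = N)
    (φ : Polynomial S) (hφ : ∀ i, Polynomial.taylor (v i) φ = φ) :
    φ ∈ Algebra.adjoin S {N} := by
  -- An invariant r takes the value r(0) at every v i, so r - r(0) has more roots than its degree
  -- allows.
  have hconst : ∀ r : Polynomial S, (∀ i, Polynomial.taylor (v i) r = r) →
      r.natDegree < N.natDegree → r ∈ Algebra.adjoin S {N} := by
    intro r hr hlt
    suffices r - Polynomial.C (r.eval 0) = 0 by
      rw [sub_eq_zero.1 this]
      exact Subalgebra.algebraMap_mem _ _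
    refine Polynomial.eq_zero_of_natDegree_lt_card_of_eval_eq_zero _ hv (fun i => ?_) ?_
    · have := congrArg (Polynomial.eval 0) (hr i)
      rw [Polynomial.taylor_eval, zero_add] at this
      simp [this]
    · rwa [Polynomial.natDegree_sub_C, ← hcard]
  induction hd : φ.natDegree using Nat.strong_induction_on generalizing φ with
  | _ d ih =>
    by_cases hlt : φ.natDegree < N.natDegree
    · exact hconst φ hφ hlt
    have hpos : 0 < N.natDegree := hcard ▸ Fintype.card_pos
    -- Translation carries a division by N to a division by N; uniqueness makes quotient and
    -- remainder invariant.
    have hinv : ∀ i, Polynomial.taylor (v i) (φ /ₘ N) = φ /ₘ N ∧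
        Polynomial.taylor (v i) (φ %ₘ N) = φ %ₘ N := by
      intro i
      have := Polynomial.div_modByMonic_unique (f := φ) (Polynomial.taylor (v i) (φ /ₘ N))
        (Polynomial.taylor (v i) (φ %ₘ N)) hN ⟨?_, ?_⟩
      · exact ⟨this.1.symm, this.2.symm⟩
      · conv_rhs => rw [← hφ i, ← Polynomial.modByMonic_add_div φ N]
        rw [map_add, Polynomial.taylor_mul, hNv]
      · rw [Polynomial.degree_taylor]
        exact Polynomial.degree_modByMonic_lt _ hN
    have hN1 : N ≠ 1 := by rintro rfl; simp at hpos
    rw [← Polynomial.modByMonic_add_div φ N]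
    refine add_mem (hconst _ (fun i => (hinv i).2) (Polynomial.natDegree_modByMonic_lt _ hN hN1))
      (mul_mem (Algebra.subset_adjoin rfl) (ih _ ?_ _ (fun i => (hinv i).1) rfl))
    rw [Polynomial.natDegree_divByMonic _ hN]
    omega

end TaylorInvariants

/-! ### Invariants as polynomials in z over F[x][y] -/

section IteratedPolynomials

variable {F : Type*} [Field F]

/-- The identification of `F[x, y, z]` with `F[x][y][z]`. -/
noncomputable def toIterated :
    MvPolynomial (Fin 3) F →ₐ[F] Polynomial (Polynomial (Polynomial F)) :=
  aeval (![Polynomial.C (Polynomial.C (Polynomial.X : Polynomial F)),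
    Polynomial.C (Polynomial.X : Polynomial (Polynomial F)), Polynomial.X])

/-- The inclusion of `F[x][y]` in `F[x, y, z]`. -/
noncomputable def ofXY : Polynomial (Polynomial F) →+* MvPolynomial (Fin 3) F :=
  Polynomial.eval₂RingHom (Polynomial.eval₂RingHom C (X 0)) (X 1)

theorem toIterated_X_zero : toIterated (F := F) (X 0) =
    Polynomial.C (Polynomial.C Polynomial.X) := by simp [toIterated]

theorem toIterated_X_one : toIterated (F := F) (X 1) = Polynomial.C Polynomial.X := by
  simp [toIterated]

theorem toIterated_X_two : toIterated (F := F) (X 2) = Polynomial.X := by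
  simp [toIterated]

theorem toIterated_C (c : F) : toIterated (C c) =
    Polynomial.C (Polynomial.C (Polynomial.C c)) := toIterated.commutes c

theorem ofXY_C_C (c : F) : ofXY (Polynomial.C (Polynomial.C c)) = C c := by simp [ofXY]

theorem ofXY_C_X : ofXY (F := F) (Polynomial.C Polynomial.X) = X 0 := by simp [ofXY]

theorem ofXY_X : ofXY (F := F) Polynomial.X = X 1 := by simp [ofXY]

theorem toIterated_injective : Function.Injective (toIterated (F := F)) := by
  have h : ((Polynomial.eval₂RingHom ofXY (X 2)).comp (toIterated (F := F)).toRingHom) =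
      RingHom.id _ := by
    refine MvPolynomial.ringHom_ext (fun c => ?_) fun i => ?_
    · simp [ofXY]
    · fin_cases i <;> simp [toIterated_X_zero, toIterated_X_one, toIterated_X_two, ofXY]
  exact Function.LeftInverse.injective (g := Polynomial.eval₂RingHom ofXY (X 2))
    fun f => DFunLike.congr_fun h f

theorem toIterated_ofXY (φ : Polynomial (Polynomial F)) :
    toIterated (ofXY φ) = Polynomial.C φ := by
  suffices ((toIterated (F := F)).toRingHom.comp ofXY) = Polynomial.C from
    DFunLike.congr_fun this φ
  refine Polynomial.ringHom_ext' (Polynomial.ringHom_ext' ?_ ?_) ?_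
  · ext c; simp [ofXY]
  · simp [ofXY, toIterated_X_zero]
  · simp [ofXY, toIterated_X_one]

/-- The translation `y ↦ y + c x` of `F[x][y]`. -/
noncomputable abbrev shiftY (c : F) : Polynomial (Polynomial F) →+* Polynomial (Polynomial F) :=
  (Polynomial.taylorAlgHom (Polynomial.C c * Polynomial.X)).toRingHom

theorem shiftY_injective (c : F) : Function.Injective (shiftY c) :=
  Polynomial.taylor_injective _

variable {p : ℕ} [CharP F p] {M : Matrix (Fin 2) (Fin 4) F}

theorem ofXY_shiftY (n : Fin 4 → ZMod p) (φ : Polynomial (Polynomial F)) :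
    ofXY (shiftY (rowValue p (M 0) n) φ) = act p M n (ofXY φ) := by
  suffices ofXY.comp (shiftY (rowValue p (M 0) n)) = (act p M n).toRingHom.comp ofXY from
    DFunLike.congr_fun this φ
  refine Polynomial.ringHom_ext' (Polynomial.ringHom_ext' ?_ ?_) ?_
  · ext c; simp [ofXY]
  · simp [ofXY, act_X_zero]
  · simp [ofXY, act_X_one]

/-- A group element shifts y in the coefficients and then translates z by an element of F[x][y]; the
coefficient of index 0 extracts this element. -/
theorem toIterated_act (n : Fin 4 → ZMod p) (f : MvPolynomial (Fin 3) F) :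
    toIterated (act p M n f) = Polynomial.taylor
      (toIterated (F := F) (act p M n (X 2) - X 2) |>.coeff 0)
      ((toIterated f).map (shiftY (rowValue p (M 0) n))) := by
  have hz : (toIterated (F := F) (act p M n (X 2) - X 2)).coeff 0 =
      Polynomial.C (Polynomial.C (2 * rowValue p (M 0) n)) * Polynomial.X +
        Polynomial.C (Polynomial.C (rowValue p (M 0) n ^ 2 + rowValue p (M 1) n) *
          Polynomial.X) := by
    have : act p M n (X 2) - X 2 = ofXY (Polynomial.C (Polynomial.C (2 * rowValue p (M 0) n)) *
        Polynomial.X + Polynomial.C (Polynomial.C (rowValue p (M 0) n ^ 2 + rowValue p (M 1) n) *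
          Polynomial.X)) := by
      rw [act_X_two]
      simp only [map_add, map_mul, map_pow, ofXY_C_C, ofXY_C_X, ofXY_X, map_ofNat]
      ring
    rw [this, toIterated_ofXY, Polynomial.coeff_C_zero]
  suffices (toIterated.toRingHom.comp (act p M n).toRingHom) = (((Polynomial.taylorAlgHom
      (toIterated (F := F) (act p M n (X 2) - X 2) |>.coeff 0)).toRingHom.comp
      (Polynomial.mapRingHom (shiftY (rowValue p (M 0) n)))).comp toIterated.toRingHom) from
    DFunLike.congr_fun this f
  refine MvPolynomial.ringHom_ext (fun c => ?_) fun i => ?_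
  · simp
  · fin_cases i
    · simp [toIterated_X_zero, act_X_zero]
    · simp [toIterated_X_one, act_X_one, toIterated_X_zero]
    · simp only [Fin.reduceFinMk, hz]
      simp [toIterated_X_two, act_X_two, toIterated_X_zero, toIterated_X_one]
      ring

/-- Translating z does not change the leading coefficient in z, so only the shift of y acts on it.
-/
theorem shiftY_leadingCoeff {f : MvPolynomial (Fin 3) F} (hf : f ∈ invariantRing p M)
    (n : Fin 4 → ZMod p) :
    shiftY (rowValue p (M 0) n) (toIterated f).leadingCoeff = (toIterated f).leadingCoeff := by
  have h := congrArg Polynomial.leadingCoeff (toIterated_act (M := M) n f)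
  rw [hf n, Polynomial.leadingCoeff_taylor,
    Polynomial.leadingCoeff_map_of_injective (shiftY_injective _)] at h
  exact h.symm

variable [Fact p.Prime]

variable (p M) in
/-- The norm of `y` as an element of `F[x][y]`. -/
noncomputable def normY : Polynomial (Polynomial F) :=
  ∏ n : Fin 4 → ZMod p,
    (Polynomial.X + Polynomial.C (Polynomial.C (rowValue p (M 0) n) * Polynomial.X))

theorem ofXY_normY (hinj : Function.Injective (rowValue p (M 0))) :
    ofXY (normY p M) = orbitNorm p M (X 1) := by
  rw [orbitNorm_X_one hinj, normY, map_prod]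
  simp [ofXY]

theorem taylor_normY (n : Fin 4 → ZMod p) :
    Polynomial.taylor (Polynomial.C (rowValue p (M 0) n) * Polynomial.X) (normY p M) =
      normY p M := by
  rw [normY, ← Polynomial.taylorAlgHom_apply, map_prod]
  refine Fintype.prod_equiv (Equiv.addLeft n) _ _ fun m => ?_
  simp [rowValue_add]
  ring

theorem leadingCoeff_mem_adjoin (hinj : Function.Injective (rowValue p (M 0)))
    {f : MvPolynomial (Fin 3) F} (hf : f ∈ invariantRing p M) :
    (toIterated f).leadingCoeff ∈ Algebra.adjoin (Polynomial F) {normY p M} := by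
  refine mem_adjoin_of_taylor_eq (ι := Fin 4 → ZMod p)
    (v := fun n => Polynomial.C (rowValue p (M 0) n) * Polynomial.X) ?_ ?_ ?_ taylor_normY _
    (shiftY_leadingCoeff hf)
  · intro m n h
    exact hinj (Polynomial.C_injective (mul_right_cancel₀ Polynomial.X_ne_zero h))
  · exact Polynomial.monic_prod_of_monic _ _ fun n _ => Polynomial.monic_X_add_C _
  · rw [normY, Polynomial.natDegree_prod_of_monic _ _ fun n _ => Polynomial.monic_X_add_C _]
    simp only [Polynomial.natDegree_X_add_C, Finset.sum_const, Finset.card_univ, smul_eq_mul,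
      mul_one]

end IteratedPolynomials

/-! ### Degree in z with leading coefficient a unit up to x -/

section ZLead

variable {F : Type*} [Field F]

/-- As a polynomial in `z`, `f` has degree `d`, and its leading coefficient is a unit of
`F[x, x⁻¹]`. -/
def HasZDegree (f : MvPolynomial (Fin 3) F) (d : ℕ) : Prop :=
  (toIterated f).natDegree = d ∧ ∃ (s t : ℕ) (κ : F), κ ≠ 0 ∧
    Polynomial.C (Polynomial.X ^ s) * (toIterated f).leadingCoeff =
      Polynomial.C (Polynomial.C κ * Polynomial.X ^ t)

theorem HasZDegree.ne_zero {f : MvPolynomial (Fin 3) F} {d : ℕ} (hf : HasZDegree f d) :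
    f ≠ 0 := by
  rintro rfl
  obtain ⟨s, t, κ, hκ, h⟩ := hf.2
  simp [hκ] at h

theorem HasZDegree.mul {f g : MvPolynomial (Fin 3) F} {d e : ℕ} (hf : HasZDegree f d)
    (hg : HasZDegree g e) : HasZDegree (f * g) (d + e) := by
  have hf0 := (map_ne_zero_iff _ toIterated_injective).2 hf.ne_zero
  have hg0 := (map_ne_zero_iff _ toIterated_injective).2 hg.ne_zero
  obtain ⟨s, t, κ, hκ, h⟩ := hf.2
  obtain ⟨s', t', κ', hκ', h'⟩ := hg.2
  refine ⟨by rw [map_mul, Polynomial.natDegree_mul hf0 hg0, hf.1, hg.1], s + s', t + t', κ * κ',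
    mul_ne_zero hκ hκ', ?_⟩
  rw [map_mul, Polynomial.leadingCoeff_mul, pow_add, Polynomial.C_mul, mul_mul_mul_comm, h, h',
    pow_add]
  simp only [Polynomial.C_mul]
  ring

theorem hasZDegree_one : HasZDegree (1 : MvPolynomial (Fin 3) F) 0 :=
  ⟨by simp, 0, 0, 1, one_ne_zero, by simp⟩

theorem HasZDegree.pow {f : MvPolynomial (Fin 3) F} {d : ℕ} (hf : HasZDegree f d) (k : ℕ) :
    HasZDegree (f ^ k) (d * k) := by
  induction k with
  | zero => simpa using hasZDegree_one
  | succ k ih => rw [pow_succ]; exact ih.mul hf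

theorem hasZDegree_prod {ι : Type*} {s : Finset ι} {f : ι → MvPolynomial (Fin 3) F}
    (hf : ∀ i ∈ s, HasZDegree (f i) 1) : HasZDegree (∏ i ∈ s, f i) s.card := by
  classical
  induction s using Finset.induction_on with
  | empty => simpa using hasZDegree_one
  | insert i s hi ih =>
    rw [Finset.prod_insert hi, Finset.card_insert_of_notMem hi, add_comm]
    exact (hf i (Finset.mem_insert_self _ _)).mul
      (ih fun j hj => hf j (Finset.mem_insert_of_mem hj))

/-- A polynomial of the form `κ x ^ t z + φ(x, y)`. -/
theorem hasZDegree_one_of_eq {f : MvPolynomial (Fin 3) F} {κ : F} (hκ : κ ≠ 0) (t : ℕ)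
    (φ : Polynomial (Polynomial F)) (hf : f = C κ * X 0 ^ t * X 2 + ofXY φ) :
    HasZDegree f 1 := by
  have : toIterated f = Polynomial.C (Polynomial.C (Polynomial.C κ * Polynomial.X ^ t)) *
      Polynomial.X + Polynomial.C φ := by
    rw [hf, map_add, map_mul, map_mul, map_pow, toIterated_C, toIterated_X_zero,
      toIterated_X_two, toIterated_ofXY]
    simp
  have h0 : Polynomial.C (Polynomial.C κ * Polynomial.X ^ t) ≠ 0 := by simp [hκ]
  refine ⟨by rw [this, Polynomial.natDegree_linear h0], 0, t, κ, hκ, ?_⟩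
  rw [this, Polynomial.leadingCoeff_linear h0, pow_zero, Polynomial.C_1, one_mul]

variable {p : ℕ} [CharP F p] [Fact p.Prime] {M : Matrix (Fin 2) (Fin 4) F}

theorem hasZDegree_orbitNorm_X_two_sub (h2 : (2 : F) ≠ 0)
    (hinj : Function.Injective (rowValue p (M 0))) (a : F) :
    HasZDegree (orbitNorm p M (X 2 - C a * X 1)) (p ^ 4) := by
  rw [orbitNorm_eq_prod (act_X_two_sub_injective h2 hinj a), ← card_group (p := p)]
  refine hasZDegree_prod fun n _ => hasZDegree_one_of_eq one_ne_zero 0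
    (Polynomial.C (Polynomial.C (2 * rowValue p (M 0) n - a)) * Polynomial.X +
      Polynomial.C (Polynomial.C (rowValue p (M 0) n ^ 2 + rowValue p (M 1) n -
        a * rowValue p (M 0) n) * Polynomial.X)) ?_
  rw [act_X_two_sub]
  simp only [map_add, map_sub, map_mul, map_pow, ofXY_C_C, ofXY_C_X, ofXY_X, C_1, pow_zero,
    map_ofNat]
  ring

end ZLead

/-! ### Spanning the invariants and their lead monomials -/

section LeadMonomialsOfInvariants

variable {F : Type*} [Field F] {p : ℕ} [CharP F p] [Fact p.Prime]
  {M : Matrix (Fin 2) (Fin 4) F}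

/-- The products `x ^ k * e i * N_M(y) ^ j * g ^ l`. -/
noncomputable def normProducts (p : ℕ) [CharP F p] [Fact p.Prime] (M : Matrix (Fin 2) (Fin 4) F)
    {ι : Type*} (e : ι → MvPolynomial (Fin 3) F) (g : MvPolynomial (Fin 3) F)
    (k : ℕ × ι × ℕ × ℕ) : MvPolynomial (Fin 3) F :=
  X 0 ^ k.1 * e k.2.1 * orbitNorm p M (X 1) ^ k.2.2.1 * g ^ k.2.2.2

theorem mul_mem_span_range {ι : Type*} {b : ι → MvPolynomial (Fin 3) F}
    {g : MvPolynomial (Fin 3) F} (hg : ∀ k, g * b k ∈ Submodule.span F (Set.range b))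
    {v : MvPolynomial (Fin 3) F} (hv : v ∈ Submodule.span F (Set.range b)) :
    g * v ∈ Submodule.span F (Set.range b) := by
  induction hv using Submodule.span_induction with
  | mem v hv => obtain ⟨k, rfl⟩ := hv; exact hg k
  | zero => simp
  | add u v _ _ hu hv => rw [mul_add]; exact add_mem hu hv
  | smul c v _ hv => rw [mul_smul_comm]; exact Submodule.smul_mem _ _ hv

variable {ι : Type*} {e : ι → MvPolynomial (Fin 3) F} {g : MvPolynomial (Fin 3) F}

theorem X_zero_mul_normProducts (k : ℕ × ι × ℕ × ℕ) :
    X 0 * normProducts p M e g k = normProducts p M e g (k.1 + 1, k.2) := by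
  simp only [normProducts]; ring

theorem X_zero_pow_mul_mem (s : ℕ) {v : MvPolynomial (Fin 3) F}
    (hv : v ∈ Submodule.span F (Set.range (normProducts p M e g))) :
    X 0 ^ s * v ∈ Submodule.span F (Set.range (normProducts p M e g)) := by
  induction s with
  | zero => simpa using hv
  | succ s ih =>
    rw [pow_succ' (X 0), mul_assoc]
    refine mul_mem_span_range (fun k => ?_) ih
    rw [X_zero_mul_normProducts]
    exact Submodule.subset_span ⟨_, rfl⟩

theorem orbitNorm_mul_mem {v : MvPolynomial (Fin 3) F}
    (hv : v ∈ Submodule.span F (Set.range (normProducts p M e g))) :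
    orbitNorm p M (X 1) * v ∈ Submodule.span F (Set.range (normProducts p M e g)) := by
  refine mul_mem_span_range (fun k => Submodule.subset_span
    ⟨(k.1, k.2.1, k.2.2.1 + 1, k.2.2.2), ?_⟩) hv
  simp only [normProducts]; ring

/-- The span is a module over F[x, N(y)], where the leading coefficients of invariants lie. -/
theorem ofXY_mul_mem (hinj : Function.Injective (rowValue p (M 0)))
    {φ : Polynomial (Polynomial F)} (hφ : φ ∈ Algebra.adjoin (Polynomial F) {normY p M})
    {v : MvPolynomial (Fin 3) F}
    (hv : v ∈ Submodule.span F (Set.range (normProducts p M e g))) :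
    ofXY φ * v ∈ Submodule.span F (Set.range (normProducts p M e g)) := by
  induction hφ using Algebra.adjoin_induction generalizing v with
  | mem φ hφ =>
    rw [Set.mem_singleton_iff.1 hφ, ofXY_normY hinj]
    exact orbitNorm_mul_mem hv
  | algebraMap r =>
    rw [Polynomial.algebraMap_eq]
    induction r using Polynomial.induction_on' with
    | add r s hr hs =>
      rw [map_add, map_add, add_mul]
      exact add_mem hr hs
    | monomial n a =>
      rw [← Polynomial.C_mul_X_pow_eq_monomial, map_mul, map_mul, map_pow, map_pow, ofXY_C_C,
        ofXY_C_X, mul_assoc, ← smul_eq_C_mul]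
      exact Submodule.smul_mem _ _ (X_zero_pow_mul_mem n hv)
  | add φ ψ _ _ hφ hψ =>
    rw [map_add, add_mul]
    exact add_mem (hφ hv) (hψ hv)
  | mul φ ψ _ _ hφ hψ =>
    rw [map_mul, mul_assoc]
    exact hφ (hψ hv)

/-- Invariants of every degree `i < p ^ 4` in `z`, and one of degree `p ^ 4`, whose leading
coefficients are powers of `x` up to units, generate the invariants after inverting `x`. -/
theorem exists_X_zero_pow_mul_mem_span (hinj : Function.Injective (rowValue p (M 0)))
    (he : ∀ i, e i ∈ invariantRing p M) {ν : ι → ℕ}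
    (hez : ∀ i, HasZDegree (e i) (ν i)) (hν : ∀ r < p ^ 4, ∃ i, ν i = r)
    (hg : g ∈ invariantRing p M) (hgz : HasZDegree g (p ^ 4))
    {f : MvPolynomial (Fin 3) F} (hf : f ∈ invariantRing p M) :
    ∃ s, X 0 ^ s * f ∈ Submodule.span F (Set.range (normProducts p M e g)) := by
  induction hd : (toIterated f).natDegree using Nat.strong_induction_on generalizing f with
  | _ d ih =>
    have hq : 0 < p ^ 4 := pow_pos (Fact.out : p.Prime).pos _
    -- The remainder of d modulo p⁴ selects e i and the quotient is the power of g, so u has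
    -- z-degree exactly d.
    obtain ⟨i, hi⟩ := hν _ (Nat.mod_lt d hq)
    set u := e i * g ^ (d / p ^ 4) with hu
    have huz : HasZDegree u d := by
      have := (hez i).mul (hgz.pow (d / p ^ 4))
      rwa [hi, Nat.mod_add_div] at this
    have huA : u ∈ invariantRing p M := mul_mem (he i) (pow_mem hg _)
    have huV : u ∈ Submodule.span F (Set.range (normProducts p M e g)) :=
      Submodule.subset_span ⟨(0, i, 0, d / p ^ 4), by simp [normProducts, hu]⟩
    obtain ⟨hud, s, t, κ, hκ, hlc⟩ := huz
    set φ := (toIterated f).leadingCoeff with hφ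
    have hφA : ofXY φ ∈ invariantRing p M := fun n => by
      rw [← ofXY_shiftY, shiftY_leadingCoeff hf]
    -- Since x^s times the leading coefficient of u is κ x^t, this combination cancels the terms of
    -- degree d in z.
    set r := C κ * X 0 ^ t * f - X 0 ^ s * ofXY φ * u with hr
    have hrA : r ∈ invariantRing p M :=
      sub_mem (mul_mem (mul_mem (Subalgebra.algebraMap_mem _ κ)
        (pow_mem (X_zero_mem_invariantRing p M) _)) hf)
        (mul_mem (mul_mem (pow_mem (X_zero_mem_invariantRing p M) _) hφA) huA)
    have hrΦ : toIterated r =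
        Polynomial.C (Polynomial.C (Polynomial.C κ * Polynomial.X ^ t)) * toIterated f -
          Polynomial.C (Polynomial.C (Polynomial.X ^ s) * φ) * toIterated u := by
      rw [hr]
      simp only [map_sub, map_mul, map_pow, toIterated_C, toIterated_X_zero, toIterated_ofXY]
    suffices ∃ s', X 0 ^ s' * r ∈ Submodule.span F (Set.range (normProducts p M e g)) by
      obtain ⟨s', hs'⟩ := this
      refine ⟨s' + t, ?_⟩
      have hmem := add_mem hs' (X_zero_pow_mul_mem (s' + s)
        (ofXY_mul_mem hinj (leadingCoeff_mem_adjoin hinj hf) huV))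
      have heq : X 0 ^ s' * r + X 0 ^ (s' + s) * (ofXY φ * u) = κ • (X 0 ^ (s' + t) * f) := by
        rw [hr, smul_eq_C_mul, pow_add, pow_add]; ring
      rw [← hφ, heq] at hmem
      have := Submodule.smul_mem _ κ⁻¹ hmem
      rwa [smul_smul, inv_mul_cancel₀ hκ, one_smul] at this
    by_cases hr0 : r = 0
    · exact ⟨0, by simp [hr0]⟩
    refine ih _ ?_ hrA rfl
    have hr0' := (map_ne_zero_iff _ toIterated_injective).2 hr0
    have hle : (toIterated r).natDegree ≤ d := by
      rw [hrΦ]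
      refine (Polynomial.natDegree_sub_le _ _).trans (max_le ?_ ?_)
      · exact (Polynomial.natDegree_C_mul_le _ _).trans hd.le
      · exact (Polynomial.natDegree_C_mul_le _ _).trans hud.le
    refine lt_of_le_of_ne hle fun heq => hr0' ?_
    rw [← Polynomial.leadingCoeff_eq_zero, Polynomial.leadingCoeff, heq, hrΦ,
      Polynomial.coeff_sub, Polynomial.coeff_C_mul, Polynomial.coeff_C_mul]
    conv_lhs =>
      congr
      · rw [← hd]
      · rw [← hud]
    rw [Polynomial.coeff_natDegree, Polynomial.coeff_natDegree, ← hφ, mul_right_comm, hlc, sub_self]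

/-- The lead monomials of the invariants. -/
theorem exists_degree_eq_of_mem_invariantRing (hinj : Function.Injective (rowValue p (M 0)))
    (he : ∀ i, e i ∈ invariantRing p M) {ν : ι → ℕ}
    (hez : ∀ i, HasZDegree (e i) (ν i)) (hν : ∀ r < p ^ 4, ∃ i, ν i = r)
    {D : ι → ℕ} (hD : ∀ i, IsYPower (e i) (D i))
    (hDinj : Function.Injective fun i => D i % p ^ 4)
    (hg : g ∈ invariantRing p M) (hgz : HasZDegree g (p ^ 4))
    (hgdeg : grevlex.degree g = Finsupp.single 2 (p ^ 4))
    {f : MvPolynomial (Fin 3) F} (hf : f ∈ invariantRing p M) (hf0 : f ≠ 0) :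
    ∃ k i j l, grevlex.degree f =
      Finsupp.single 0 k + Finsupp.single 1 (D i + p ^ 4 * j) + Finsupp.single 2 (p ^ 4 * l) := by
  have hq : 0 < p ^ 4 := pow_pos (Fact.out : p.Prime).pos _
  have hNy := (isYPower_orbitNorm_X_one hinj).degree_eq
  have hb : ∀ k, normProducts p M e g k ≠ 0 := fun k =>
    mul_ne_zero (mul_ne_zero (mul_ne_zero (pow_ne_zero _ (X_ne_zero 0)) (hD _).degree_eq.1)
      (pow_ne_zero _ hNy.1)) (pow_ne_zero _ hgz.ne_zero)
  have hdeg : ∀ k, grevlex.degree (normProducts p M e g k) = Finsupp.single 0 k.1 +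
      Finsupp.single 1 (D k.2.1 + p ^ 4 * k.2.2.1) + Finsupp.single 2 (p ^ 4 * k.2.2.2) := by
    intro k
    have h4 := hb k
    have h3 := left_ne_zero_of_mul h4
    have h2 := left_ne_zero_of_mul h3
    rw [normProducts, grevlex.degree_mul h3 (right_ne_zero_of_mul h4),
      grevlex.degree_mul h2 (right_ne_zero_of_mul h3),
      grevlex.degree_mul (left_ne_zero_of_mul h2) (right_ne_zero_of_mul h2), grevlex.degree_pow,
      grevlex.degree_pow, grevlex.degree_pow, hgdeg, hNy.2, (hD _).degree_eq.2,
      MonomialOrder.degree_X, Finsupp.single_add]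
    simp [mul_comm, add_assoc]
  have hbinj : Function.Injective fun k => grevlex.degree (normProducts p M e g k) := by
    rintro ⟨k, i, j, l⟩ ⟨k', i', j', l'⟩ h
    simp only [hdeg] at h
    have h0 := DFunLike.congr_fun h 0
    have h1 := DFunLike.congr_fun h 1
    have h2 := DFunLike.congr_fun h 2
    simp at h0 h1 h2
    -- Modulo p⁴ the exponent of y is D i, which determines i; then j and l follow from the
    -- exponents of y and z.
    have hi : i = i' := by
      refine hDinj ?_
      have h1' := congrArg (fun m => m % p ^ 4) h1
      beta_reduce at h1'
      rwa [Nat.add_mul_mod_self_left, Nat.add_mul_mod_self_left] at h1'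
    subst hi
    have hp : p ≠ 0 := (Fact.out : p.Prime).ne_zero
    simp [hp] at h1 h2
    simp [h0, h1, h2]
  have hx : ∀ k, grevlex.degree (normProducts p M e g k) 0 = 0 ∨
      ∃ k', normProducts p M e g k = X 0 * normProducts p M e g k' := by
    rintro ⟨k, k'⟩
    cases k with
    | zero => left; rw [hdeg]; simp
    | succ k =>
      refine Or.inr ⟨(k, k'), ?_⟩
      rw [X_zero_mul_normProducts]
  have hmem : ∀ s, X 0 ^ s * f ∈ Submodule.span F (Set.range (normProducts p M e g)) →
      f ∈ Submodule.span F (Set.range (normProducts p M e g)) := by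
    intro s
    induction s with
    | zero => simp
    | succ s ih =>
      intro h
      rw [pow_succ' (X 0), mul_assoc] at h
      exact ih (mem_span_of_X_zero_mul_mem hb hbinj hx h)
  obtain ⟨s, hs⟩ := exists_X_zero_pow_mul_mem_span hinj he hez hν hg hgz hf
  obtain ⟨c, hc⟩ := Finsupp.mem_span_range_iff_exists_finsupp.1 (hmem s hs)
  rw [← Finsupp.linearCombination_apply] at hc
  have hc0 : c ≠ 0 := by rintro rfl; exact hf0 (by simpa using hc.symm)
  obtain ⟨-, k, -, hk⟩ := degree_linearCombination hb hbinj hc0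
  rw [hc, hdeg] at hk
  exact ⟨_, _, _, _, hk⟩

end LeadMonomialsOfInvariants

/-! ### Consequences of the conditions on the minors -/

section Minors

variable {F : Type*} [Field F]

theorem det_of_row_two_three {R : Type*} [CommRing R] (a b c d : Fin 4 → R) (A B C D : R) :
    Matrix.det (Matrix.of ![a, fun j => A * a j + B * b j + C * c j + D * d j, b, c]) =
      D * Matrix.det (Matrix.of ![a, b, c, d]) := by
  simp [Matrix.det_succ_row_zero, Fin.sum_univ_succ, Fin.succAbove]
  ring

theorem det_of_row_two_four {R : Type*} [CommRing R] (a b c d : Fin 4 → R) (A B C A' B' C' : R) :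
    Matrix.det (Matrix.of ![a, fun j => A * a j + B * b j + C * c j, b,
        fun j => A' * b j + B' * c j + C' * d j]) =
      -(C * C') * Matrix.det (Matrix.of ![a, b, c, d]) := by
  simp [Matrix.det_succ_row_zero, Fin.sum_univ_succ, Fin.succAbove]
  ring

theorem det_of_row_two {R : Type*} [CommRing R] (a b c d : Fin 4 → R) (A B : R) :
    Matrix.det (Matrix.of ![a, fun j => A * a j + B * b j, c, d]) =
      B * Matrix.det (Matrix.of ![a, b, c, d]) := by
  simp [Matrix.det_succ_row_zero, Fin.sum_univ_succ, Fin.succAbove]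
  ring

theorem det_of_row_one {R : Type*} [CommRing R] (a b c d : Fin 4 → R) (A B : R) :
    Matrix.det (Matrix.of ![fun j => A * a j + B * b j, b, c, d]) =
      A * Matrix.det (Matrix.of ![a, b, c, d]) := by
  simp [Matrix.det_succ_row_zero, Fin.sum_univ_succ, Fin.succAbove]
  ring

variable (p : ℕ)

/-- The coefficients that express a vector in terms of the rows `1, 3, 5, 7` of `Γ(M)`. -/
theorem exists_eq_sum_rows {M : Matrix (Fin 2) (Fin 4) F} (h : gamma p M 1 3 5 7 ≠ 0)
    (v : Fin 4 → F) : ∃ t : Fin 4 → F, ∀ j, v j =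
      t 0 * M 0 j + t 1 * M 0 j ^ p + t 2 * M 0 j ^ p ^ 2 + t 3 * M 0 j ^ p ^ 3 := by
  set G := Matrix.of ![gammaRow p M 1, gammaRow p M 3, gammaRow p M 5, gammaRow p M 7] with hG
  have hu : IsUnit G.det := isUnit_iff_ne_zero.2 h
  refine ⟨Matrix.vecMul v G⁻¹, fun j => ?_⟩
  have hv : Matrix.vecMul (Matrix.vecMul v G⁻¹) G = v := by
    rw [Matrix.vecMul_vecMul, Matrix.nonsing_inv_mul _ hu, Matrix.vecMul_one]
  conv_lhs => rw [← hv]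
  rw [Matrix.vecMul, dotProduct, Fin.sum_univ_four]
  simp [hG, gammaRow]

variable [Fact p.Prime] [CharP F p]

/-- Expand row 2 in rows 1, 3, 5, 7 with coefficients t. Then γ₁₂₃₅ = t₃ γ₁₃₅₇ gives t₃ = 0.
Frobenius expands row 4, so γ₁₂₃₄ = -t₂^(p+1) γ₁₃₅₇ gives t₂ = 0. -/
theorem exists_row_eq {M : Matrix (Fin 2) (Fin 4) F} (h1234 : gamma p M 1 2 3 4 = 0)
    (h1235 : gamma p M 1 2 3 5 = 0) (h1357 : gamma p M 1 3 5 7 ≠ 0) :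
    ∃ A B : F, (∀ j, M 1 j = A * M 0 j + B * M 0 j ^ p) ∧
      gamma p M 1 2 5 7 = B * gamma p M 1 3 5 7 ∧ gamma p M 2 3 5 7 = A * gamma p M 1 3 5 7 := by
  obtain ⟨t, ht⟩ := exists_eq_sum_rows p h1357 (M 1)
  have r1 : gammaRow p M 1 = fun j => M 0 j := by ext j; simp [gammaRow]
  have r2 : gammaRow p M 2 = fun j => M 1 j := by ext j; simp [gammaRow]
  have r3 : gammaRow p M 3 = fun j => M 0 j ^ p := by ext j; simp [gammaRow]
  have r4 : gammaRow p M 4 = fun j => M 1 j ^ p := by ext j; simp [gammaRow]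
  have r5 : gammaRow p M 5 = fun j => M 0 j ^ p ^ 2 := by ext j; simp [gammaRow]
  have r7 : gammaRow p M 7 = fun j => M 0 j ^ p ^ 3 := by ext j; simp [gammaRow]
  have h3 : t 3 = 0 := by
    rw [gamma, r1, r2, r3, r5] at h1235
    simp_rw [ht] at h1235
    rw [det_of_row_two_three _ _ _ (fun j => M 0 j ^ p ^ 3), ← r1, ← r3, ← r5, ← r7,
      mul_eq_zero] at h1235
    exact h1235.resolve_right h1357
  simp_rw [h3, zero_mul, add_zero] at ht
  have h2 : t 2 = 0 := by
    have hr4 : (fun j => M 1 j ^ p) = fun j => t 0 ^ p * M 0 j ^ p + t 1 ^ p * M 0 j ^ p ^ 2 +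
        t 2 ^ p * M 0 j ^ p ^ 3 := by
      ext j
      rw [ht, add_pow_char, add_pow_char, mul_pow, mul_pow, mul_pow, ← pow_mul, ← pow_mul,
        ← pow_two, ← pow_succ]
    rw [gamma, r1, r2, r3, r4, hr4] at h1234
    simp_rw [ht] at h1234
    rw [det_of_row_two_four, ← r1, ← r3, ← r5, ← r7, mul_eq_zero] at h1234
    have := h1234.resolve_right h1357
    rw [neg_eq_zero, mul_eq_zero] at this
    exact this.elim id eq_zero_of_pow_eq_zero
  simp_rw [h2, zero_mul, add_zero] at ht
  refine ⟨t 0, t 1, ht, ?_, ?_⟩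
  · rw [gamma, gamma, r1, r2, r3, r5, r7]
    simp_rw [ht]
    rw [det_of_row_two]
  · rw [gamma, gamma, r1, r2, r3, r5, r7]
    simp_rw [ht]
    rw [det_of_row_one]

variable {p}

theorem castHom_pow (m : ℕ) (x : ZMod p) :
    ZMod.castHom (dvd_refl p) F x ^ p ^ m = ZMod.castHom (dvd_refl p) F x := by
  rw [← map_pow, ZMod.pow_card_pow]

theorem rowValue_pow (c : Fin 4 → F) (m : ℕ) (n : Fin 4 → ZMod p) :
    rowValue p c n ^ p ^ m = rowValue p (fun j => c j ^ p ^ m) n := by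
  rw [rowValue, rowValue, sum_pow_char_pow]
  simp_rw [mul_pow, castHom_pow]

/-- Frobenius fixes the prime field, so a dependency among the c₁ⱼ with coefficients there also
holds for their p^m-th powers. It is then killed by the matrix with determinant γ₁₃₅₇. -/
theorem rowValue_injective {M : Matrix (Fin 2) (Fin 4) F} (h : gamma p M 1 3 5 7 ≠ 0) :
    Function.Injective (rowValue p (M 0)) := by
  let φ : (Fin 4 → ZMod p) →+ F := AddMonoidHom.mk' (rowValue p (M 0)) (rowValue_add p _)
  refine (injective_iff_map_eq_zero φ).2 fun n (hn : rowValue p (M 0) n = 0) => ?_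
  have hp : p ≠ 0 := (Fact.out : p.Prime).ne_zero
  have hrow : ∀ m, ∑ j, M 0 j ^ p ^ m * ZMod.castHom (dvd_refl p) F (n j) = 0 := by
    intro m
    have := rowValue_pow (M 0) m n
    rw [hn, zero_pow (pow_ne_zero _ hp)] at this
    rw [this, rowValue]
    exact Finset.sum_congr rfl fun j _ => mul_comm _ _
  have hz := Matrix.eq_zero_of_mulVec_eq_zero (v := fun j => ZMod.castHom (dvd_refl p) F (n j))
    h (by
      ext i
      rw [Matrix.mulVec, dotProduct]
      fin_cases i
      · simpa [gammaRow] using hrow 0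
      · simpa [gammaRow] using hrow 1
      · simpa [gammaRow] using hrow 2
      · simpa [gammaRow] using hrow 3)
  ext j
  exact (map_eq_zero_iff _ (ZMod.castHom (dvd_refl p) F).injective).1 (congrFun hz j)

end Minors

/-! ### The symmetric square of a two-dimensional representation -/

section SymmetricSquare

variable {F : Type*} [Field F]

/-- The quadratic map `x ↦ u², y ↦ uv, z ↦ v² + a uv`. -/
noncomputable def squareMap (a : F) : MvPolynomial (Fin 3) F →ₐ[F] MvPolynomial (Fin 2) F :=
  aeval ![X 0 ^ 2, X 0 * X 1, X 1 ^ 2 + C a * X 0 * X 1]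

theorem squareMap_linear (a r s t : F) :
    squareMap a (C r * X 0 + C s * X 1 + C t * X 2) =
      C r * X 0 ^ 2 + C (s + t * a) * (X 0 * X 1) + C t * X 1 ^ 2 := by
  have hC : ∀ c, squareMap a (C c) = C c := fun c => (squareMap a).commutes c
  simp only [map_add, map_mul, hC]
  simp [squareMap]
  ring

theorem exists_eq_of_isHomogeneous_one {f : MvPolynomial (Fin 3) F} (hf : f.IsHomogeneous 1) :
    ∃ r s t : F, f = C r * X 0 + C s * X 1 + C t * X 2 := by
  have hf' : f ∈ homogeneousSubmodule (Fin 3) F 1 := hf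
  rw [homogeneousSubmodule_one_eq_span_X, Submodule.mem_span_range_iff_exists_fun] at hf'
  obtain ⟨c, hc⟩ := hf'
  refine ⟨c 0, c 1, c 2, ?_⟩
  rw [← hc, Fin.sum_univ_three]
  simp only [smul_eq_C_mul]

theorem exists_eq_of_isHomogeneous_two {f : MvPolynomial (Fin 2) F} (hf : f.IsHomogeneous 2) :
    ∃ r s t : F, f = C r * X 0 ^ 2 + C s * (X 0 * X 1) + C t * X 1 ^ 2 := by
  classical
  have hne : ∀ i j k l : ℕ, (i ≠ k ∨ j ≠ l) →
      Finsupp.single (0 : Fin 2) i + Finsupp.single 1 j ≠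
        Finsupp.single 0 k + Finsupp.single 1 l := by
    intro i j k l h heq
    have h0 := DFunLike.congr_fun heq 0
    have h1 := DFunLike.congr_fun heq 1
    simp at h0 h1
    omega
  have hmon : ∀ (i j : ℕ) (c : F), C c * (X 0 ^ i * X 1 ^ j) =
      monomial (Finsupp.single (0 : Fin 2) i + Finsupp.single 1 j) c := by
    intro i j c
    rw [X_pow_eq_monomial, X_pow_eq_monomial, monomial_mul, C_mul_monomial, mul_one, mul_one]
  refine ⟨coeff (Finsupp.single 0 2 + Finsupp.single 1 0) f,
    coeff (Finsupp.single 0 1 + Finsupp.single 1 1) f,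
    coeff (Finsupp.single 0 0 + Finsupp.single 1 2) f, ?_⟩
  have e1 := hmon 2 0
  have e2 := hmon 1 1
  have e3 := hmon 0 2
  simp only [pow_zero, mul_one, pow_one, one_mul] at e1 e2 e3
  rw [e1, e2, e3]
  ext m
  rw [coeff_add, coeff_add, coeff_monomial, coeff_monomial, coeff_monomial]
  have hm : m = Finsupp.single 0 (m 0) + Finsupp.single 1 (m 1) := by
    ext i; fin_cases i <;> simp
  by_cases hdeg : m 0 + m 1 = 2
  · generalize m 0 = i at hm hdeg
    generalize m 1 = j at hm hdeg
    subst hm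
    have hi : i ≤ 2 := by omega
    interval_cases i
    · obtain rfl : j = 2 := by omega
      rw [if_neg (hne _ _ _ _ (by omega)), if_neg (hne _ _ _ _ (by omega)), if_pos rfl]; simp
    · obtain rfl : j = 1 := by omega
      rw [if_neg (hne _ _ _ _ (by omega)), if_pos rfl, if_neg (hne _ _ _ _ (by omega))]; simp
    · obtain rfl : j = 0 := by omega
      rw [if_pos rfl, if_neg (hne _ _ _ _ (by omega)), if_neg (hne _ _ _ _ (by omega))]; simp
  · rw [hf.coeff_eq_zero (by rwa [Finsupp.degree_eq_sum, Fin.sum_univ_two])]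
    rw [hm, if_neg (hne _ _ _ _ (by omega)), if_neg (hne _ _ _ _ (by omega)),
      if_neg (hne _ _ _ _ (by omega))]
    simp

theorem bijOn_squareMap (a : F) :
    Set.BijOn (squareMap a) (homogeneousSubmodule (Fin 3) F 1)
      (homogeneousSubmodule (Fin 2) F 2) := by
  refine ⟨fun f hf => ?_, fun f hf g hg hfg => ?_, fun f hf => ?_⟩
  · obtain ⟨r, s, t, rfl⟩ := exists_eq_of_isHomogeneous_one hf
    rw [squareMap_linear]
    exact (((isHomogeneous_X_pow _ _).C_mul _).add
      (((isHomogeneous_X _ _).mul (isHomogeneous_X _ _)).C_mul _)).add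
      ((isHomogeneous_X_pow _ _).C_mul _)
  · obtain ⟨r, s, t, rfl⟩ := exists_eq_of_isHomogeneous_one hf
    obtain ⟨r', s', t', rfl⟩ := exists_eq_of_isHomogeneous_one hg
    rw [squareMap_linear, squareMap_linear] at hfg
    -- Three evaluations recover the coefficients of u², v² and uv.
    have h1 := congrArg (eval ![1, 0]) hfg
    have h2 := congrArg (eval ![0, 1]) hfg
    have h3 := congrArg (eval ![1, 1]) hfg
    simp at h1 h2 h3
    subst h1 h2
    simp at h3
    rw [h3]
  · obtain ⟨r, s, t, rfl⟩ := exists_eq_of_isHomogeneous_two hf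
    refine ⟨C r * X 0 + C (s - t * a) * X 1 + C t * X 2, ?_, ?_⟩
    · exact ((isHomogeneous_C_mul_X _ _).add (isHomogeneous_C_mul_X _ _)).add
        (isHomogeneous_C_mul_X _ _)
    · rw [squareMap_linear, sub_add_cancel]

theorem isSymmetricSquareOf_of_row_eq {p : ℕ} [CharP F p] {M : Matrix (Fin 2) (Fin 4) F} {a : F}
    (ha : ∀ n, rowValue p (M 1) n = a * rowValue p (M 0) n) : IsSymmetricSquareOf p M (M 0) := by
  refine ⟨squareMap a, fun n f => ?_, bijOn_squareMap a⟩
  suffices (squareMap a).comp (act p M n) = (actTwo p (M 0) n).comp (squareMap a) from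
    DFunLike.congr_fun this f
  have hC : ∀ c, squareMap a (C c) = C c := fun c => (squareMap a).commutes c
  have hC' : ∀ c, actTwo p (M 0) n (C c) = C c := fun c => (actTwo p (M 0) n).commutes c
  have s0 : squareMap a (X 0) = X 0 ^ 2 := by simp [squareMap]
  have s1 : squareMap a (X 1) = X 0 * X 1 := by simp [squareMap]
  have s2 : squareMap a (X 2) = X 1 ^ 2 + C a * X 0 * X 1 := by simp [squareMap]
  have t0 : actTwo p (M 0) n (X 0) = X 0 := by simp [actTwo]
  have t1 : actTwo p (M 0) n (X 1) = X 1 + C (rowValue p (M 0) n) * X 0 := by simp [actTwo]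
  refine MvPolynomial.algHom_ext fun i => ?_
  rw [AlgHom.comp_apply, AlgHom.comp_apply]
  fin_cases i
  · simp only [Fin.zero_eta, act_X_zero, s0, map_pow, t0]
  · simp only [Fin.mk_one, act_X_one, s0, s1, map_add, map_mul, t0, t1, hC]; ring
  · simp only [Fin.reduceFinMk, act_X_two, s0, s1, s2, map_add, map_mul, map_pow, t0, t1, hC, hC',
      ha, map_ofNat]
    ring

end SymmetricSquare

/-! ### Lead monomials of products of the generators -/

section Assembly

variable {F : Type*} [Field F] {h : Fin 4 → MvPolynomial (Fin 3) F}

theorem degree_hpow_cons (hh : ∀ i, h i ≠ 0) {d : Fin 4 → ℕ}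
    (h0 : grevlex.degree (h 0) = Finsupp.single 0 1)
    (h1 : grevlex.degree (h 1) = Finsupp.single 1 (d 1))
    (h2 : grevlex.degree (h 2) = Finsupp.single 1 (d 2))
    (h3 : grevlex.degree (h 3) = Finsupp.single 2 (d 3)) (k i j l : ℕ) :
    grevlex.degree (hpow h (Finsupp.equivFunOnFinite.symm ![k, i, j, l])) =
      Finsupp.single 0 k + Finsupp.single 1 (d 1 * i + d 2 * j) + Finsupp.single 2 (d 3 * l) := by
  rw [degree_hpow hh, Fin.sum_univ_four, h0, h1, h2, h3, Finsupp.single_add]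
  simp [mul_comm, add_assoc]

end Assembly

/-! ### The case of proportional rows -/

section SymmetricSquareCase

variable {F : Type*} [Field F] {p : ℕ} [CharP F p] {M : Matrix (Fin 2) (Fin 4) F} {a : F}

theorem isYPower_discriminant (a : F) :
    IsYPower (X 1 ^ 2 - X 0 * (X 2 - C a * X 1) : MvPolynomial (Fin 3) F) 2 :=
  ⟨(isHomogeneous_X_pow _ _).sub ((isHomogeneous_X _ _).mul ((isHomogeneous_X _ _).sub
    (isHomogeneous_C_mul_X _ _))), ⟨-(X 2 - C a * X 1), by ring⟩⟩

theorem hasZDegree_discriminant (a : F) :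
    HasZDegree (X 1 ^ 2 - X 0 * (X 2 - C a * X 1) : MvPolynomial (Fin 3) F) 1 := by
  refine hasZDegree_one_of_eq (neg_ne_zero.2 one_ne_zero) 1 (Polynomial.X ^ 2 +
    Polynomial.C Polynomial.X * Polynomial.C (Polynomial.C a) * Polynomial.X) ?_
  simp only [map_add, map_mul, map_pow, ofXY_C_C, ofXY_C_X, ofXY_X, C_neg, C_1]
  ring

/-- The form y² - xz changes by -c₂x² and a·xy by a c₁x²; these cancel when c₂ = a c₁. -/
theorem discriminant_mem (ha : ∀ n, rowValue p (M 1) n = a * rowValue p (M 0) n) :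
    X 1 ^ 2 - X 0 * (X 2 - C a * X 1) ∈ invariantRing p M := by
  intro n
  rw [map_sub, map_mul, act_X_two_sub, map_pow, act_X_one, act_X_zero, ha]
  simp only [map_add, map_sub, map_mul, map_pow, map_ofNat]
  ring

/-- The powers δ'^i with i < p⁴ have z-degree i and lead monomials y^(2i), whose exponents are
distinct modulo p⁴ because p is odd. -/
theorem sagbi_hypersurface_of_row_eq [Fact p.Prime] (hp : 2 < p)
    (hinj : Function.Injective (rowValue p (M 0)))
    (ha : ∀ n, rowValue p (M 1) n = a * rowValue p (M 0) n) :
    IsSagbiBasis {X 0, X 1 ^ 2 - X 0 * (X 2 - C a * X 1), orbitNorm p M (X 1),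
        orbitNorm p M (X 2 - C a * X 1)} (invariantRing p M) ∧
      IsHypersurface (invariantRing p M)
        ![X 0, X 1 ^ 2 - X 0 * (X 2 - C a * X 1), orbitNorm p M (X 1),
          orbitNorm p M (X 2 - C a * X 1)]
        ![1, 2, p ^ 4, p ^ 4]
        (Finsupp.single 1 (p ^ 4)) (Finsupp.single 2 2) (2 * p ^ 4) := by
  have h2 := two_ne_zero_of_lt F hp
  have hq : 0 < p ^ 4 := pow_pos (by omega) 4
  have hcop : Nat.Coprime (p ^ 4) 2 := Nat.Coprime.pow_left 4
    ((Nat.coprime_primes Fact.out Nat.prime_two).2 (by omega))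
  have hδ := isYPower_discriminant a
  have hNy := isYPower_orbitNorm_X_one hinj
  have hNz := degree_orbitNorm_X_two_sub h2 hinj a
  set h : Fin 4 → MvPolynomial (Fin 3) F := ![X 0, X 1 ^ 2 - X 0 * (X 2 - C a * X 1),
    orbitNorm p M (X 1), orbitNorm p M (X 2 - C a * X 1)] with hh
  have hne : ∀ i, h i ≠ 0 := by
    intro i
    fin_cases i
    exacts [X_ne_zero 0, hδ.degree_eq.1, hNy.degree_eq.1, hNz.1]
  have hA : ∀ i, h i ∈ invariantRing p M := by
    intro i
    fin_cases i
    exacts [X_zero_mem_invariantRing p M, discriminant_mem ha, orbitNorm_X_one_mem hinj,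
      orbitNorm_X_two_sub_mem h2 hinj a]
  have d0 : grevlex.degree (h 0) = Finsupp.single 0 1 := MonomialOrder.degree_X
  have hLM : ∀ f ∈ invariantRing p M, f ≠ 0 →
      ∃ K, grevlex.degree f = grevlex.degree (hpow h K) := by
    intro f hf hf0
    obtain ⟨k, i, j, l, hdeg⟩ := exists_degree_eq_of_mem_invariantRing (ι := Fin (p ^ 4)) hinj
      (e := fun i => (X 1 ^ 2 - X 0 * (X 2 - C a * X 1)) ^ (i : ℕ)) (ν := fun i => 1 * i)
      (D := fun i => 2 * i) (fun i => pow_mem (discriminant_mem ha) _)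
      (fun i => (hasZDegree_discriminant a).pow _) (fun r hr => ⟨⟨r, hr⟩, one_mul r⟩)
      (fun i => hδ.pow _) (fun i j hij => Fin.ext (Nat.ModEq.eq_of_lt_of_lt
        (Nat.ModEq.cancel_left_of_coprime hcop hij) i.2 j.2))
      (orbitNorm_X_two_sub_mem h2 hinj a) (hasZDegree_orbitNorm_X_two_sub h2 hinj a) hNz.2 hf hf0
    exact ⟨_, hdeg.trans (degree_hpow_cons (d := ![1, 2, p ^ 4, p ^ 4]) hne d0 hδ.degree_eq.2
      hNy.degree_eq.2 hNz.2 k i j l).symm⟩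
  constructor
  · have := isSagbiBasis_range hne hA hLM
    rw [hh] at this
    simpa only [Matrix.range_cons, Matrix.range_empty, Set.union_empty, Set.singleton_union]
      using this
  · rw [mul_comm 2]
    refine isHypersurface_of_degree (i := 1) (j := 2) (d := ![1, 2, p ^ 4, p ^ 4]) hne hA hLM ?_
      d0 hδ.degree_eq.2 hNy.degree_eq.2 hNz.2 ?_ (Or.inl ⟨rfl, rfl⟩) hcop
    · intro i
      fin_cases i
      exacts [isHomogeneous_X _ _, hδ.1, hNy.1, isHomogeneous_orbitNorm_X_two_sub h2 hinj a]
    · intro i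
      fin_cases i
      exacts [one_pos, two_pos, hq, hq]

end SymmetricSquareCase

/-! ### The telescoping subduction modulo a power of x -/

section Congruences

theorem exponent_bounds {p : ℕ} (hp : 2 < p) :
    3 * p ≤ p ^ 2 ∧ 3 * p ^ 2 ≤ p ^ 3 ∧ 3 * p ^ 3 ≤ p ^ 4 := by
  refine ⟨?_, ?_, ?_⟩
  · rw [pow_two]; exact Nat.mul_le_mul_right _ hp
  · rw [pow_succ' p 2]; exact Nat.mul_le_mul_right _ hp
  · rw [pow_succ' p 3]; exact Nat.mul_le_mul_right _ hp

/-- One stage of the cancellation: modulo x^s only the square and the cross term of G² survive. The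
cross term is the source of the successive factors 2 in the subduction. -/
theorem pow_dvd_mul_sq_sub {R : Type*} [CommRing R] {x H U V A B G : R} {e f s : ℕ}
    (hH : x ^ s ∣ H - U) (hG : G = V + A * x ^ e + x ^ f * B) (hf : s ≤ f) (he : s ≤ 2 * e) :
    x ^ s ∣ H * G ^ 2 - U * (V ^ 2 + 2 * V * A * x ^ e) := by
  have h1 : H * G ^ 2 - U * (V ^ 2 + 2 * V * A * x ^ e) = (H - U) * G ^ 2 +
      (x ^ (2 * e) * (U * A ^ 2) + x ^ f * (U * B * (2 * V + 2 * A * x ^ e + x ^ f * B))) := by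
    rw [hG, two_mul e, pow_add]; ring
  rw [h1]
  exact dvd_add (hH.mul_right _) (dvd_add ((pow_dvd_pow x he).mul_right _)
    ((pow_dvd_pow x hf).mul_right _))

/-- The expansion of a polynomial of the shape of `h2tilde` modulo a power of `x`. -/
theorem pow_dvd_subduction {R : Type*} [CommRing R] {p : ℕ} [Fact p.Prime] [CharP R p]
    (hp : 2 < p) {x y a r h N : R} (hh : h = y ^ p + a * y ^ 2 * x ^ (p - 2) + x ^ (p - 1) * r)
    (hN : x ^ (p ^ 4 - p ^ 3) ∣ N - y ^ p ^ 4) :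
    x ^ (p ^ 4 - p ^ 3 - p ^ 2 - p - 1) ∣
      N - h ^ p ^ 3 + a ^ p ^ 3 * h ^ (2 * p ^ 2) * x ^ (p ^ 4 - 2 * p ^ 3)
        - 2 * a ^ (p ^ 3 + p ^ 2) * h ^ (p ^ 2 + 2 * p) * x ^ (p ^ 4 - p ^ 3 - 2 * p ^ 2)
        + 4 * a ^ (p ^ 3 + p ^ 2 + p) * h ^ (p ^ 2 + p + 2)
          * x ^ (p ^ 4 - p ^ 3 - p ^ 2 - 2 * p)
        - 8 * a ^ (p ^ 3 + p ^ 2 + p + 1) * x ^ (p ^ 4 - p ^ 3 - p ^ 2 - p - 2)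
          * y ^ (p ^ 3 + p ^ 2 + p + 2) := by
  -- In characteristic p the three-term shape of h persists under p^m-th powers.
  have hfrob : ∀ m, h ^ p ^ m = y ^ p ^ (m + 1) + a ^ p ^ m * (y ^ p ^ m) ^ 2 *
      x ^ (p ^ (m + 1) - 2 * p ^ m) + x ^ (p ^ (m + 1) - p ^ m) * r ^ p ^ m := by
    intro m
    rw [hh, add_pow_char_pow, add_pow_char_pow, mul_pow, mul_pow, mul_pow, ← pow_mul, ← pow_mul,
      ← pow_mul, ← pow_mul, ← pow_mul, tsub_mul, tsub_mul, one_mul, ← pow_succ',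
      mul_comm 2 (p ^ m)]
  obtain ⟨l2, l3, l4⟩ := exponent_bounds hp
  have f3 := hfrob 3
  have f2 := hfrob 2
  have f1 := hfrob 1
  simp only [Nat.reduceAdd, pow_one] at f1 f2 f3
  have c1 : x ^ (p ^ 3 - p ^ 2 - p - 1) ∣ (1 : R) * (h ^ p ^ 2) ^ 2 - 1 * ((y ^ p ^ 3) ^ 2 +
      2 * y ^ p ^ 3 * (a ^ p ^ 2 * (y ^ p ^ 2) ^ 2) * x ^ (p ^ 3 - 2 * p ^ 2)) :=
    pow_dvd_mul_sq_sub (by simp) f2 (by omega) (by omega)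
  have d2 : ∀ s, s ≤ p ^ 3 - 2 * p ^ 2 → x ^ s ∣ h ^ p ^ 2 - y ^ p ^ 3 := by
    intro s hs
    rw [f2, add_assoc, add_sub_cancel_left]
    exact dvd_add ((pow_dvd_pow x hs).mul_left _) ((pow_dvd_pow x (by omega)).mul_right _)
  have d1 : ∀ s, s ≤ p ^ 2 - 2 * p → x ^ s ∣ h ^ p - y ^ p ^ 2 := by
    intro s hs
    rw [f1, add_assoc, add_sub_cancel_left]
    exact dvd_add ((pow_dvd_pow x hs).mul_left _) ((pow_dvd_pow x (by omega)).mul_right _)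
  have c2 : x ^ (p ^ 2 - p - 1) ∣ h ^ p ^ 2 * (h ^ p) ^ 2 - y ^ p ^ 3 * ((y ^ p ^ 2) ^ 2 +
      2 * y ^ p ^ 2 * (a ^ p * (y ^ p) ^ 2) * x ^ (p ^ 2 - 2 * p)) :=
    pow_dvd_mul_sq_sub (d2 _ (by omega)) f1 (by omega) (by omega)
  -- Here the bound s ≤ 2e reads p - 1 ≤ 2(p - 2), which is where p > 2 is needed.
  have c3 : x ^ (p - 1) ∣ h ^ p ^ 2 * h ^ p * h ^ 2 - y ^ p ^ 3 * y ^ p ^ 2 * ((y ^ p) ^ 2 +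
      2 * y ^ p * (a * y ^ 2) * x ^ (p - 2)) := by
    refine pow_dvd_mul_sq_sub ?_ hh le_rfl (by omega)
    have : h ^ p ^ 2 * h ^ p - y ^ p ^ 3 * y ^ p ^ 2 =
        (h ^ p ^ 2 - y ^ p ^ 3) * h ^ p + y ^ p ^ 3 * (h ^ p - y ^ p ^ 2) := by ring
    rw [this]
    exact dvd_add ((d2 _ (by omega)).mul_right _) ((d1 _ (by omega)).mul_left _)
  have c0 : x ^ (p ^ 4 - p ^ 3) ∣ N - y ^ p ^ 4 - x ^ (p ^ 4 - p ^ 3) * r ^ p ^ 3 :=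
    dvd_sub hN (dvd_mul_right _ _)
  have x1 : x ^ (p ^ 4 - 2 * p ^ 3) * x ^ (p ^ 3 - 2 * p ^ 2) =
      x ^ (p ^ 4 - p ^ 3 - 2 * p ^ 2) := by
    rw [← pow_add]; congr 1; omega
  have x2 : x ^ (p ^ 4 - p ^ 3 - 2 * p ^ 2) * x ^ (p ^ 2 - 2 * p) =
      x ^ (p ^ 4 - p ^ 3 - p ^ 2 - 2 * p) := by
    rw [← pow_add]; congr 1; omega
  have x3 : x ^ (p ^ 4 - p ^ 3 - p ^ 2 - 2 * p) * x ^ (p - 2) =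
      x ^ (p ^ 4 - p ^ 3 - p ^ 2 - p - 2) := by
    rw [← pow_add]; congr 1; omega
  have t0 := (pow_dvd_pow x (show p ^ 4 - p ^ 3 - p ^ 2 - p - 1 ≤ p ^ 4 - p ^ 3 by omega)).trans c0
  have t1 := mul_dvd_mul_left (x ^ (p ^ 4 - 2 * p ^ 3)) c1
  have t2 := mul_dvd_mul_left (x ^ (p ^ 4 - p ^ 3 - 2 * p ^ 2)) c2
  have t3 := mul_dvd_mul_left (x ^ (p ^ 4 - p ^ 3 - p ^ 2 - 2 * p)) c3
  rw [← pow_add, show p ^ 4 - 2 * p ^ 3 + (p ^ 3 - p ^ 2 - p - 1) =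
    p ^ 4 - p ^ 3 - p ^ 2 - p - 1 by omega] at t1
  rw [← pow_add, show p ^ 4 - p ^ 3 - 2 * p ^ 2 + (p ^ 2 - p - 1) =
    p ^ 4 - p ^ 3 - p ^ 2 - p - 1 by omega] at t2
  rw [← pow_add, show p ^ 4 - p ^ 3 - p ^ 2 - 2 * p + (p - 1) =
    p ^ 4 - p ^ 3 - p ^ 2 - p - 1 by omega] at t3
  -- Each correction cancels the lowest-order term left by the previous one and leaves its own cross
  -- term. The coefficients -1, 2, -4, 8 arise in turn, and only the last term remains modulo the
  -- stated power of x.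
  have key := dvd_add (dvd_sub (dvd_add t0 (t1.mul_left (a ^ p ^ 3)))
    (t2.mul_left (2 * a ^ (p ^ 3 + p ^ 2)))) (t3.mul_left (4 * a ^ (p ^ 3 + p ^ 2 + p)))
  convert key using 1
  rw [f3]
  linear_combination (2 * y ^ (2 * p ^ 2) * y ^ p ^ 3 * a ^ p ^ 2 * a ^ p ^ 3) * x1 -
    (4 * y ^ (2 * p) * y ^ p ^ 2 * y ^ p ^ 3 * a ^ p * a ^ p ^ 2 * a ^ p ^ 3) * x2 +
    (8 * y ^ 2 * y ^ p * y ^ p ^ 2 * y ^ p ^ 3 * a * a ^ p * a ^ p ^ 2 * a ^ p ^ 3) * x3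

end Congruences

/-! ### The norm of y as an additive polynomial -/

section NormExpansion

variable {F : Type*} [Field F] {p : ℕ} [Fact p.Prime] [CharP F p] {M : Matrix (Fin 2) (Fin 4) F}

/-- The norm of `y` is an additive polynomial. -/
theorem exists_normY_eq (h1357 : gamma p M 1 3 5 7 ≠ 0) : ∃ t : Fin 4 → F,
    normY p M = Polynomial.X ^ p ^ 4 - ∑ m : Fin 4, Polynomial.C (Polynomial.C (t m) *
      Polynomial.X ^ (p ^ 4 - p ^ (m : ℕ))) * Polynomial.X ^ p ^ (m : ℕ) := by
  have hp1 : 1 < p := (Fact.out : p.Prime).one_lt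
  -- Expanding the p⁴-th powers of row 1 in rows 1, 3, 5, 7 gives an additive polynomial vanishing
  -- at all p⁴ points w x. The norm is monic of the same degree with the same roots.
  obtain ⟨t, ht⟩ := exists_eq_sum_rows p h1357 fun j => M 0 j ^ p ^ 4
  have hw : ∀ n, rowValue p (M 0) n ^ p ^ 4 =
      ∑ m : Fin 4, t m * rowValue p (M 0) n ^ p ^ (m : ℕ) := by
    intro n
    simp_rw [rowValue_pow, ht]
    rw [Fin.sum_univ_four]
    simp only [rowValue, Finset.mul_sum, ← Finset.sum_add_distrib]
    refine Finset.sum_congr rfl fun j _ => ?_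
    simp
    ring
  refine ⟨t, ?_⟩
  set S : Polynomial (Polynomial F) := ∑ m : Fin 4, Polynomial.C (Polynomial.C (t m) *
      Polynomial.X ^ (p ^ 4 - p ^ (m : ℕ))) * Polynomial.X ^ p ^ (m : ℕ) with hS
  have hlt : ∀ m : Fin 4, p ^ (m : ℕ) < p ^ 4 := fun m => Nat.pow_lt_pow_right hp1 m.2
  have hSdeg : S.degree < ((p ^ 4 : ℕ) : WithBot ℕ) := by
    refine (Polynomial.degree_sum_le _ _).trans_lt ((Finset.sup_lt_iff ?_).2 fun m _ => ?_)
    · exact WithBot.bot_lt_coe _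
    · exact (Polynomial.degree_C_mul_X_pow_le _ _).trans_lt (by exact_mod_cast hlt m)
  have hmon : (normY p M).Monic :=
    Polynomial.monic_prod_of_monic _ _ fun n _ => Polynomial.monic_X_add_C _
  have hdeg : (normY p M).natDegree = p ^ 4 := by
    rw [normY, Polynomial.natDegree_prod_of_monic _ _ fun n _ => Polynomial.monic_X_add_C _,
      ← card_group (p := p)]
    simp only [Polynomial.natDegree_X_add_C, Finset.sum_const, Finset.card_univ, smul_eq_mul,
      mul_one]
  have hinj := rowValue_injective h1357
  have hXS : (Polynomial.X ^ p ^ 4 - S).degree = ((p ^ 4 : ℕ) : WithBot ℕ) := by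
    rw [Polynomial.degree_sub_eq_left_of_degree_lt (by rwa [Polynomial.degree_X_pow]),
      Polynomial.degree_X_pow]
  have hXSmon : (Polynomial.X ^ p ^ 4 - S).leadingCoeff = 1 := by
    rw [Polynomial.leadingCoeff_sub_of_degree_lt (by rwa [Polynomial.degree_X_pow]),
      Polynomial.leadingCoeff_X_pow]
  have hNdeg : (normY p M).degree = ((p ^ 4 : ℕ) : WithBot ℕ) := by
    rw [Polynomial.degree_eq_natDegree hmon.ne_zero, hdeg]
  refine Polynomial.eq_of_degree_sub_lt_of_eval_index_eq
    (v := fun n : Fin 4 → ZMod p => Polynomial.C (rowValue p (M 0) n) * Polynomial.X) Finset.univ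
    ?_ ?_ fun n _ => ?_
  · intro m _ n _ h
    exact hinj (Polynomial.C_injective (mul_right_cancel₀ Polynomial.X_ne_zero h))
  · rw [Finset.card_univ, card_group, ← hNdeg]
    exact Polynomial.degree_sub_lt_left (hNdeg.trans hXS.symm) hmon.ne_zero
      (hmon.leadingCoeff.trans hXSmon.symm)
  · have hneg : rowValue p (M 0) n + rowValue p (M 0) (-n) = 0 := by
      rw [← rowValue_add, add_neg_cancel]; simp [rowValue]
    have h0 : (normY p M).eval (Polynomial.C (rowValue p (M 0) n) * Polynomial.X) = 0 := by
      rw [normY, Polynomial.eval_prod]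
      -- The factors are y + w x, so the root for n comes from the factor of -n.
      refine Finset.prod_eq_zero (Finset.mem_univ (-n)) ?_
      rw [Polynomial.eval_add, Polynomial.eval_X, Polynomial.eval_C, ← add_mul,
        ← Polynomial.C_add, hneg, Polynomial.C_0, zero_mul]
    rw [h0, Polynomial.eval_sub, Polynomial.eval_pow, Polynomial.eval_X, hS,
      Polynomial.eval_finsetSum, eq_comm, sub_eq_zero, mul_pow, ← Polynomial.C_pow, hw, map_sum,
      Finset.sum_mul]
    refine Finset.sum_congr rfl fun m _ => ?_
    rw [Polynomial.eval_mul, Polynomial.eval_C, Polynomial.eval_pow, Polynomial.eval_X, mul_pow,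
      ← Polynomial.C_pow, Polynomial.C_mul, mul_mul_mul_comm, ← pow_add,
      Nat.sub_add_cancel (hlt m).le]

theorem X_zero_pow_dvd_orbitNorm_sub (h1357 : gamma p M 1 3 5 7 ≠ 0) :
    X 0 ^ (p ^ 4 - p ^ 3) ∣ orbitNorm p M (X 1) - X 1 ^ p ^ 4 := by
  obtain ⟨t, ht⟩ := exists_normY_eq h1357
  rw [← ofXY_normY (rowValue_injective h1357), ht, map_sub, map_pow, ofXY_X, sub_sub_cancel_left,
    map_sum, dvd_neg]
  refine Finset.dvd_sum fun m _ => ?_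
  rw [map_mul, Polynomial.C_mul, map_mul, Polynomial.C_pow, map_pow, ofXY_C_X]
  refine Dvd.dvd.mul_right (Dvd.dvd.mul_left (pow_dvd_pow _ (Nat.sub_le_sub_left ?_ _)) _) _
  exact Nat.pow_le_pow_right (Fact.out : p.Prime).pos (by omega)

end NormExpansion

/-! ### The invariant h₁ -/

section HOne

variable {F : Type*} [Field F] {p : ℕ} {M : Matrix (Fin 2) (Fin 4) F}

theorem isYPower_h1 (hp : 2 < p) : IsYPower (h1 p M) p := by
  constructor
  · refine ((isHomogeneous_X_pow _ _).add ?_).add ?_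
    · have hδ : (delta : MvPolynomial (Fin 3) F).IsHomogeneous 2 :=
        (isHomogeneous_X_pow _ _).sub ((isHomogeneous_X _ _).mul (isHomogeneous_X _ _))
      have := (hδ.C_mul (gamma p M 1 3 5 7 / gamma p M 1 2 5 7)).mul
        (isHomogeneous_X_pow (R := F) (0 : Fin 3) (p - 2))
      rwa [Nat.add_sub_cancel' hp.le] at this
    · have := (isHomogeneous_C_mul_X (gamma p M 2 3 5 7 / gamma p M 1 2 5 7) (1 : Fin 3)).mul
        (isHomogeneous_X_pow (R := F) (0 : Fin 3) (p - 1))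
      rwa [Nat.add_sub_cancel' (by omega)] at this
  · rw [h1, add_assoc, add_sub_cancel_left]
    exact dvd_add ((dvd_pow_self _ (by omega)).mul_left _) ((dvd_pow_self _ (by omega)).mul_left _)

theorem hasZDegree_h1 (hp : 2 < p) (hα : gamma p M 1 3 5 7 / gamma p M 1 2 5 7 ≠ 0) :
    HasZDegree (h1 p M) 1 := by
  refine hasZDegree_one_of_eq (neg_ne_zero.2 hα) (p - 1) (Polynomial.X ^ p +
    Polynomial.C (Polynomial.C (gamma p M 1 3 5 7 / gamma p M 1 2 5 7)) * Polynomial.X ^ 2 *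
      Polynomial.C Polynomial.X ^ (p - 2) +
    Polynomial.C (Polynomial.C (gamma p M 2 3 5 7 / gamma p M 1 2 5 7)) * Polynomial.X *
      Polynomial.C Polynomial.X ^ (p - 1)) ?_
  rw [h1, delta]
  simp only [map_add, map_mul, map_pow, ofXY_C_C, ofXY_C_X, ofXY_X, map_neg]
  rw [show p - 1 = p - 2 + 1 by omega]
  ring

/-- Under the action y^p, δ and y change by c₁^p x^p, -c₂x² and c₁x. The changes in h₁ add up to
(c₁^p - B⁻¹c₂ + AB⁻¹c₁) x^p, which is zero. -/
theorem h1_mem [Fact p.Prime] [CharP F p] (hp : 2 < p) {A B : F} (hB : B ≠ 0)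
    (hb : ∀ n, rowValue p (M 1) n = A * rowValue p (M 0) n + B * rowValue p (M 0) n ^ p)
    (hα : gamma p M 1 3 5 7 / gamma p M 1 2 5 7 = B⁻¹)
    (hβ : gamma p M 2 3 5 7 / gamma p M 1 2 5 7 = A * B⁻¹) : h1 p M ∈ invariantRing p M := by
  intro n
  rw [h1, delta, hα, hβ]
  simp only [map_add, map_sub, map_mul, map_pow, act_X_zero, act_X_one, act_X_two, act_C, hb,
    map_ofNat]
  rw [add_pow_char, mul_pow, ← map_pow]
  -- Removes the truncated subtractions from the exponents.
  obtain ⟨m, rfl⟩ : ∃ m, p = m + 2 := ⟨p - 2, by omega⟩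
  rw [show m + 2 - 1 = m + 1 by omega, Nat.add_sub_cancel]
  have hC : (C B⁻¹ * C B : MvPolynomial (Fin 3) F) = 1 := by rw [← C_mul, inv_mul_cancel₀ hB, C_1]
  simp only [map_pow]
  linear_combination (-(C (rowValue (m + 2) (M 0) n) ^ (m + 2) * X 0 ^ (m + 2)) :
    MvPolynomial (Fin 3) F) * hC

/-- The form of `h1` that exhibits its terms of low degree in `x`. -/
theorem h1_eq (hp : 2 < p) : h1 p M = X 1 ^ p +
    C (gamma p M 1 3 5 7 / gamma p M 1 2 5 7) * X 1 ^ 2 * X 0 ^ (p - 2) + X 0 ^ (p - 1) *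
      (C (gamma p M 2 3 5 7 / gamma p M 1 2 5 7) * X 1 -
        C (gamma p M 1 3 5 7 / gamma p M 1 2 5 7) * X 2) := by
  rw [h1, delta, show p - 1 = p - 2 + 1 by omega]
  ring

end HOne

/-! ### The invariant h₂ -/

section HTwo

variable {F : Type*} [Field F]

theorem isHomogeneous_of_X_zero_pow_mul {f : MvPolynomial (Fin 3) F} {k n : ℕ}
    (hf : (X 0 ^ k * f).IsHomogeneous (k + n)) : f.IsHomogeneous n := by
  intro m hm
  have hcoeff : coeff (Finsupp.single 0 k + m) (X 0 ^ k * f) ≠ 0 := by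
    rwa [X_pow_eq_monomial, coeff_monomial_mul, one_mul]
  have := hf hcoeff
  rw [map_add, Finsupp.weight_single] at this
  simpa using this

theorem HasZDegree.add_of_lt {f g : MvPolynomial (Fin 3) F} {d : ℕ} (hf : HasZDegree f d)
    (hg : (toIterated g).natDegree < d) : HasZDegree (f + g) d := by
  have hlt : (toIterated g).natDegree < (toIterated f).natDegree :=
    hg.trans_eq hf.1.symm
  obtain ⟨s, t, κ, hκ, h⟩ := hf.2
  refine ⟨?_, s, t, κ, hκ, ?_⟩
  · rw [map_add, Polynomial.natDegree_add_eq_left_of_natDegree_lt hlt, hf.1]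
  · have hadd := Polynomial.leadingCoeff_add_of_degree_lt' (Polynomial.degree_lt_degree hlt)
    rw [map_add, hadd, h]

theorem hasZDegree_C {κ : F} (hκ : κ ≠ 0) : HasZDegree (C κ) 0 := by
  refine ⟨by rw [toIterated_C, Polynomial.natDegree_C], 0, 0, κ, hκ, ?_⟩
  rw [toIterated_C, Polynomial.leadingCoeff_C, pow_zero, Polynomial.C_1, one_mul, mul_one]

theorem HasZDegree.neg {f : MvPolynomial (Fin 3) F} {d : ℕ} (hf : HasZDegree f d) :
    HasZDegree (-f) d := by
  have := (hasZDegree_C (neg_ne_zero.2 (one_ne_zero (α := F)))).mul hf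
  rwa [C_neg, C_1, neg_one_mul, zero_add] at this

theorem HasZDegree.of_C_mul_X_pow_mul {f : MvPolynomial (Fin 3) F} {d k : ℕ} {c : F} (hc : c ≠ 0)
    (hf : HasZDegree (C c * X 0 ^ k * f) d) : HasZDegree f d := by
  have hΦ : toIterated (C c * X 0 ^ k * f) =
      Polynomial.C (Polynomial.C (Polynomial.C c * Polynomial.X ^ k)) * toIterated f := by
    simp only [map_mul, map_pow, toIterated_C, toIterated_X_zero]
  have hne : Polynomial.C (Polynomial.C c * Polynomial.X ^ k) ≠ 0 := by simp [hc]
  obtain ⟨hd, s, t, κ, hκ, h⟩ := hf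
  rw [hΦ, Polynomial.natDegree_C_mul hne] at hd
  refine ⟨hd, s + k, t, κ / c, div_ne_zero hκ hc, ?_⟩
  rw [hΦ, Polynomial.leadingCoeff_mul, Polynomial.leadingCoeff_C] at h
  have hc' : Polynomial.C (Polynomial.C c) ≠ 0 := by simpa using hc
  refine mul_left_cancel₀ hc' ?_
  rw [← Polynomial.C_mul, ← mul_assoc (Polynomial.C c), ← Polynomial.C_mul, mul_div_cancel₀ _ hc,
    ← h, pow_add]
  simp only [Polynomial.C_mul]
  ring

theorem natDegree_toIterated_mul_pow_mul_le {f : MvPolynomial (Fin 3) F} (hf : HasZDegree f 1)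
    (c : F) (m l : ℕ) : (toIterated (C c * f ^ m * X 0 ^ l)).natDegree ≤ m := by
  have h1 : (toIterated (f ^ m)).natDegree = 1 * m := (hf.pow m).1
  rw [map_mul, map_mul, map_pow _ _ l, toIterated_C, toIterated_X_zero, ← Polynomial.C_pow]
  refine (Polynomial.natDegree_mul_C_le _ _).trans ((Polynomial.natDegree_C_mul_le _ _).trans ?_)
  rw [h1, one_mul]

variable {p : ℕ} [Fact p.Prime] [CharP F p] {M : Matrix (Fin 2) (Fin 4) F}

theorem h2tilde_mem (hinj : Function.Injective (rowValue p (M 0)))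
    (h1A : h1 p M ∈ invariantRing p M) (α : F) : h2tilde p M α ∈ invariantRing p M := by
  have hC : ∀ c : F, C c ∈ invariantRing p M := fun c => Subalgebra.algebraMap_mem _ c
  have hX : ∀ k, X 0 ^ k ∈ invariantRing p M := fun k => pow_mem (X_zero_mem_invariantRing p M) k
  exact add_mem (sub_mem (add_mem (sub_mem (orbitNorm_X_one_mem hinj) (pow_mem h1A _))
    (mul_mem (mul_mem (hC _) (pow_mem h1A _)) (hX _)))
    (mul_mem (mul_mem (hC _) (pow_mem h1A _)) (hX _)))
    (mul_mem (mul_mem (hC _) (pow_mem h1A _)) (hX _))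

theorem isHomogeneous_h2tilde (hp : 2 < p) (hinj : Function.Injective (rowValue p (M 0)))
    (α : F) : (h2tilde p M α).IsHomogeneous (p ^ 4) := by
  obtain ⟨l2, l3, l4⟩ := exponent_bounds hp
  have hterm : ∀ (c : F) (m l : ℕ), p * m + l = p ^ 4 →
      (C c * h1 p M ^ m * X 0 ^ l).IsHomogeneous (p ^ 4) := by
    intro c m l h
    have := (((isYPower_h1 (M := M) hp).1.pow m).C_mul c).mul
      (isHomogeneous_X_pow (R := F) (0 : Fin 3) l)
    rwa [h] at this
  have e2 : p * p ^ 2 = p ^ 3 := by ring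
  have e1 : p * p = p ^ 2 := by ring
  refine ((((isYPower_orbitNorm_X_one hinj).1.sub ?_).add (hterm _ _ _ ?_)).sub
    (hterm _ _ _ ?_)).add (hterm _ _ _ ?_)
  · have := (isYPower_h1 (M := M) hp).1.pow (p ^ 3)
    rwa [← pow_succ'] at this
  · rw [mul_left_comm, e2]; omega
  · rw [mul_add, mul_left_comm p 2, e2, e1]; omega
  · rw [mul_add, mul_add, e2, e1]; omega

/-- The term h₁^(p³) dominates in z: the other powers of h₁ have exponents below p³, and N(y) does
not involve z. -/
theorem hasZDegree_h2tilde (hp : 2 < p) (hinj : Function.Injective (rowValue p (M 0)))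
    (hα : gamma p M 1 3 5 7 / gamma p M 1 2 5 7 ≠ 0) (α : F) :
    HasZDegree (h2tilde p M α) (p ^ 3) := by
  obtain ⟨l2, l3, l4⟩ := exponent_bounds hp
  have h := hasZDegree_h1 hp hα
  have hsplit : h2tilde p M α = -h1 p M ^ p ^ 3 + (orbitNorm p M (X 1) +
      C (α ^ p ^ 3) * h1 p M ^ (2 * p ^ 2) * X 0 ^ (p ^ 4 - 2 * p ^ 3) +
      (C (-(2 * α ^ (p ^ 3 + p ^ 2))) * h1 p M ^ (p ^ 2 + 2 * p) *
        X 0 ^ (p ^ 4 - p ^ 3 - 2 * p ^ 2)) +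
      C (4 * α ^ (p ^ 3 + p ^ 2 + p)) * h1 p M ^ (p ^ 2 + p + 2) *
        X 0 ^ (p ^ 4 - p ^ 3 - p ^ 2 - 2 * p)) := by
    rw [h2tilde, C_neg]; ring
  have hlt : ∀ (c : F) (m l : ℕ), m < p ^ 3 →
      (toIterated (C c * h1 p M ^ m * X 0 ^ l)).natDegree < p ^ 3 := fun c m l hm =>
    (natDegree_toIterated_mul_pow_mul_le h c m l).trans_lt hm
  have hadd : ∀ f g : MvPolynomial (Fin 3) F, (toIterated f).natDegree < p ^ 3 →
      (toIterated g).natDegree < p ^ 3 → (toIterated (f + g)).natDegree < p ^ 3 := by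
    intro f g hf hg
    rw [map_add]
    exact (Polynomial.natDegree_add_le _ _).trans_lt (max_lt hf hg)
  rw [hsplit]
  refine HasZDegree.add_of_lt ?_ (hadd _ _ (hadd _ _ (hadd _ _ ?_ (hlt _ _ _ ?_))
    (hlt _ _ _ ?_)) (hlt _ _ _ ?_))
  · have := (h.pow (p ^ 3)).neg
    rwa [one_mul] at this
  · rw [← ofXY_normY hinj, toIterated_ofXY, Polynomial.natDegree_C]
    omega
  all_goals omega

/-- Existence and properties of `h₂`. -/
theorem exists_isH2 (hp : 2 < p) (h1357 : gamma p M 1 3 5 7 ≠ 0) (h1257 : gamma p M 1 2 5 7 ≠ 0)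
    (h1A : h1 p M ∈ invariantRing p M) : ∃ h₂, IsH2 p M h₂ ∧ h₂ ∈ invariantRing p M ∧
      IsYPower h₂ (p ^ 3 + p ^ 2 + p + 2) ∧ HasZDegree h₂ (p ^ 3) := by
  obtain ⟨l2, l3, l4⟩ := exponent_bounds hp
  have hinj := rowValue_injective h1357
  have hα := div_ne_zero h1357 h1257
  set α := gamma p M 1 3 5 7 / gamma p M 1 2 5 7 with hαdef
  have h2 := two_ne_zero_of_lt F hp
  have h8 : (8 : F) ≠ 0 := by
    rw [show (8 : F) = 2 ^ 3 by norm_num]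
    exact pow_ne_zero _ h2
  set c := 8 * α ^ (p ^ 3 + p ^ 2 + p + 1) with hcdef
  have hc : c ≠ 0 := mul_ne_zero h8 (pow_ne_zero _ hα)
  set k := p ^ 4 - p ^ 3 - p ^ 2 - p - 2 with hk
  -- The role of r is played by βy - αz, with β the coefficient of y x^(p-1) in h₁.
  obtain ⟨g, hg⟩ := pow_dvd_subduction hp (h1_eq (M := M) hp) (X_zero_pow_dvd_orbitNorm_sub h1357)
  have hg' : h2tilde p M α = C c * X 0 ^ k * X 1 ^ (p ^ 3 + p ^ 2 + p + 2) +
      X 0 ^ (k + 1) * g := by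
    rw [show k + 1 = p ^ 4 - p ^ 3 - p ^ 2 - p - 1 by omega, ← hg, h2tilde, hcdef]
    simp only [C_mul, C_pow, map_ofNat]
    ring
  set h₂ : MvPolynomial (Fin 3) F := X 1 ^ (p ^ 3 + p ^ 2 + p + 2) + X 0 * (C c⁻¹ * g) with hh₂
  have hCc : (C c * C c⁻¹ : MvPolynomial (Fin 3) F) = 1 := by
    rw [← C_mul, mul_inv_cancel₀ hc, C_1]
  have hmul : C c * X 0 ^ k * h₂ = h2tilde p M α := by
    rw [hg', hh₂]
    linear_combination (X 0 ^ (k + 1) * g) * hCc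
  have hne : C c * X 0 ^ k ≠ (0 : MvPolynomial (Fin 3) F) :=
    mul_ne_zero (by simpa using hc) (pow_ne_zero _ (X_ne_zero 0))
  refine ⟨h₂, hmul, mem_invariantRing_of_mul_mem hne ?_ ?_, ⟨?_, ?_⟩, ?_⟩
  · exact mul_mem (Subalgebra.algebraMap_mem _ c) (pow_mem (X_zero_mem_invariantRing p M) _)
  · rw [hmul]
    exact h2tilde_mem hinj h1A α
  · refine isHomogeneous_of_X_zero_pow_mul (k := k) ?_
    have h := (isHomogeneous_h2tilde (M := M) hp hinj α).C_mul c⁻¹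
    rw [← hmul, mul_assoc, ← mul_assoc (C c⁻¹), mul_comm (C c⁻¹), hCc, one_mul] at h
    rwa [show k + (p ^ 3 + p ^ 2 + p + 2) = p ^ 4 by omega]
  · rw [hh₂, add_sub_cancel_left]
    exact dvd_mul_right _ _
  · refine HasZDegree.of_C_mul_X_pow_mul (k := k) hc ?_
    rw [hmul]
    exact hasZDegree_h2tilde hp hinj hα α

end HTwo

/-! ### The case γ₁₂₅₇ ≠ 0 -/

section GenericCase

variable {F : Type*} [Field F] {p : ℕ} [Fact p.Prime] [CharP F p] {M : Matrix (Fin 2) (Fin 4) F}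

/-- Reduction modulo p recovers b, since n is prime to p; cancelling p then recovers a modulo p³. -/
theorem mod_injective_of_coprime {n : ℕ} (hcop : Nat.Coprime p n) {a a' b b' : ℕ}
    (ha : a < p ^ 3) (ha' : a' < p ^ 3) (hb : b < p) (hb' : b' < p)
    (h : p * a + n * b ≡ p * a' + n * b' [MOD p ^ 4]) : a = a' ∧ b = b' := by
  have hpp : p ∣ p ^ 4 := dvd_pow_self p (by norm_num)
  have h1 : n * b ≡ n * b' [MOD p] := by
    have := h.of_dvd hpp
    simpa [Nat.ModEq, Nat.add_mod] using this
  have hbb : b = b' :=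
    Nat.ModEq.eq_of_lt_of_lt (Nat.ModEq.cancel_left_of_coprime hcop h1) hb hb'
  subst hbb
  have h2 : p * a ≡ p * a' [MOD p * p ^ 3] := by
    rw [← pow_succ']
    exact Nat.ModEq.add_right_cancel' _ h
  exact ⟨Nat.ModEq.eq_of_lt_of_lt
    (Nat.ModEq.mul_left_cancel' (Fact.out : p.Prime).ne_zero h2) ha ha', rfl⟩

theorem sagbi_hypersurface_of_isH2 (hp : 2 < p) (hinj : Function.Injective (rowValue p (M 0)))
    (hα : gamma p M 1 3 5 7 / gamma p M 1 2 5 7 ≠ 0) (h1A : h1 p M ∈ invariantRing p M)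
    {h₂ : MvPolynomial (Fin 3) F} (h2A : h₂ ∈ invariantRing p M)
    (h2y : IsYPower h₂ (p ^ 3 + p ^ 2 + p + 2)) (h2z : HasZDegree h₂ (p ^ 3)) :
    IsSagbiBasis {X 0, h1 p M, h₂, orbitNorm p M (X 2)} (invariantRing p M) ∧
      IsHypersurface (invariantRing p M) ![X 0, h1 p M, h₂, orbitNorm p M (X 2)]
        ![1, p, p ^ 3 + p ^ 2 + p + 2, p ^ 4]
        (Finsupp.single 2 p) (Finsupp.single 1 (p ^ 3 + p ^ 2 + p + 2))
        (p ^ 4 + p ^ 3 + p ^ 2 + 2 * p) := by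
  have h2 := two_ne_zero_of_lt F hp
  have hp0 : 0 < p := by omega
  have hcop : Nat.Coprime p (p ^ 3 + p ^ 2 + p + 2) := by
    rw [show p ^ 3 + p ^ 2 + p + 2 = 2 + p * (p ^ 2 + p + 1) by ring,
      Nat.coprime_add_mul_left_right]
    exact (Nat.coprime_primes Fact.out Nat.prime_two).2 (by omega)
  have h1y := isYPower_h1 (M := M) hp
  have h1z := hasZDegree_h1 hp hα
  -- The norm of z is the instance a = 0 of the norms studied above.
  have hX2 : X 2 - C 0 * X 1 = (X 2 : MvPolynomial (Fin 3) F) := by simp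
  have hNz := degree_orbitNorm_X_two_sub h2 hinj 0
  have hNzA := orbitNorm_X_two_sub_mem h2 hinj 0
  have hNzz := hasZDegree_orbitNorm_X_two_sub h2 hinj 0
  have hNzh := isHomogeneous_orbitNorm_X_two_sub h2 hinj 0
  rw [hX2] at hNz hNzA hNzz hNzh
  set n := p ^ 3 + p ^ 2 + p + 2 with hn
  set h : Fin 4 → MvPolynomial (Fin 3) F := ![X 0, h1 p M, h₂, orbitNorm p M (X 2)] with hh
  have hne : ∀ i, h i ≠ 0 := by
    intro i
    fin_cases i
    exacts [X_ne_zero 0, h1y.degree_eq.1, h2y.degree_eq.1, hNz.1]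
  have hA : ∀ i, h i ∈ invariantRing p M := by
    intro i
    fin_cases i
    exacts [X_zero_mem_invariantRing p M, h1A, h2A, hNzA]
  have d0 : grevlex.degree (h 0) = Finsupp.single 0 1 := MonomialOrder.degree_X
  have hLM : ∀ f ∈ invariantRing p M, f ≠ 0 →
      ∃ K, grevlex.degree f = grevlex.degree (hpow h K) := by
    intro f hf hf0
    obtain ⟨k, i, j, l, hdeg⟩ := exists_degree_eq_of_mem_invariantRing
      (ι := Fin (p ^ 3) × Fin p) hinj
      (e := fun i => h1 p M ^ (i.1 : ℕ) * h₂ ^ (i.2 : ℕ)) (ν := fun i => 1 * i.1 + p ^ 3 * i.2)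
      (D := fun i => p * i.1 + n * i.2) (fun i => mul_mem (pow_mem h1A _) (pow_mem h2A _))
      (fun i => (h1z.pow _).mul (h2z.pow _))
      -- Division by p³ writes each r < p⁴ as the z-degree of h₁^a h₂^b.
      (fun r hr => ⟨(⟨r % p ^ 3, Nat.mod_lt _ (pow_pos hp0 3)⟩,
        ⟨r / p ^ 3, Nat.div_lt_of_lt_mul (by rwa [← pow_succ])⟩), by
          rw [one_mul]; exact Nat.mod_add_div r _⟩)
      (fun i => (h1y.pow _).mul (h2y.pow _))
      (fun i j hij => by
        obtain ⟨h1, h2⟩ := mod_injective_of_coprime hcop i.1.2 j.1.2 i.2.2 j.2.2 hij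
        exact Prod.ext (Fin.ext h1) (Fin.ext h2))
      hNzA hNzz hNz.2 hf hf0
    -- The lead monomial y^(p⁴) of N(y) is that of h₁^(p³), so N(y) is not needed as a generator.
    refine ⟨_, hdeg.trans ((degree_hpow_cons (d := ![1, p, n, p ^ 4]) hne d0 h1y.degree_eq.2
      h2y.degree_eq.2 hNz.2 k (i.1 + p ^ 3 * j) i.2 l).trans ?_).symm⟩
    rw [show p * (i.1 : ℕ) + n * i.2 + p ^ 4 * j = p * (i.1 + p ^ 3 * j) + n * i.2 by ring]
    rfl
  constructor
  · have := isSagbiBasis_range hne hA hLM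
    rw [hh] at this
    simpa only [Matrix.range_cons, Matrix.range_empty, Set.union_empty, Set.singleton_union]
      using this
  · rw [show p ^ 4 + p ^ 3 + p ^ 2 + 2 * p = p * n by rw [hn]; ring]
    refine isHypersurface_of_degree (i := 2) (j := 1) (d := ![1, p, n, p ^ 4]) hne hA hLM ?_
      d0 h1y.degree_eq.2 h2y.degree_eq.2 hNz.2 ?_ (Or.inr ⟨rfl, rfl⟩) hcop
    · intro i
      fin_cases i
      exacts [isHomogeneous_X _ _, h1y.1, h2y.1, hNzh]
    · intro i
      fin_cases i
      exacts [one_pos, hp0, Nat.succ_pos _, pow_pos hp0 4]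

end GenericCase

/-! ### The two cases combined -/

theorem mainTheorem7 {F : Type*} [Field F] (p : ℕ) [Fact p.Prime] [CharP F p] (hp : 2 < p)
    (M : Matrix (Fin 2) (Fin 4) F)
    (h1234 : gamma p M 1 2 3 4 = 0) (h1235 : gamma p M 1 2 3 5 = 0)
    (h1357 : gamma p M 1 3 5 7 ≠ 0) :
    (gamma p M 1 2 5 7 ≠ 0 →
      ∃ h₂ : MvPolynomial (Fin 3) F, IsH2 p M h₂ ∧
        IsSagbiBasis {X 0, h1 p M, h₂, orbitNorm p M (X 2)} (invariantRing p M) ∧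
        IsHypersurface (invariantRing p M) ![X 0, h1 p M, h₂, orbitNorm p M (X 2)]
          ![1, p, p ^ 3 + p ^ 2 + p + 2, p ^ 4]
          (Finsupp.single 2 p) (Finsupp.single 1 (p ^ 3 + p ^ 2 + p + 2))
          (p ^ 4 + p ^ 3 + p ^ 2 + 2 * p)) ∧
    (gamma p M 1 2 5 7 = 0 →
      ∃ a : F, M 1 = a • M 0 ∧ IsSymmetricSquareOf p M (M 0) ∧
        IsSagbiBasis {X 0, X 1 ^ 2 - X 0 * (X 2 - C a * X 1), orbitNorm p M (X 1),
            orbitNorm p M (X 2 - C a * X 1)} (invariantRing p M) ∧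
        IsHypersurface (invariantRing p M)
          ![X 0, X 1 ^ 2 - X 0 * (X 2 - C a * X 1), orbitNorm p M (X 1),
            orbitNorm p M (X 2 - C a * X 1)]
          ![1, 2, p ^ 4, p ^ 4]
          (Finsupp.single 1 (p ^ 4)) (Finsupp.single 2 2) (2 * p ^ 4)) := by
  obtain ⟨A, B, hM, hB, hA⟩ := exists_row_eq p h1234 h1235 h1357
  have hinj := rowValue_injective h1357
  have hrow : ∀ n, rowValue p (M 1) n = A * rowValue p (M 0) n + B * rowValue p (M 0) n ^ p := by
    intro n
    have hpow := rowValue_pow (M 0) 1 n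
    rw [pow_one] at hpow
    rw [hpow, ← rowValue_linear, ← funext hM]
  refine ⟨fun h1257 => ?_, fun h1257 => ?_⟩
  · have hB0 : B ≠ 0 := by
      rintro rfl
      exact h1257 (by rw [hB, zero_mul])
    have h1A : h1 p M ∈ invariantRing p M := by
      refine h1_mem hp hB0 hrow ?_ ?_
      · rw [hB]; field_simp
      · rw [hA, hB]; field_simp
    obtain ⟨h₂, hIs, h2A, h2y, h2z⟩ := exists_isH2 hp h1357 h1257 h1A
    exact ⟨h₂, hIs, sagbi_hypersurface_of_isH2 hp hinj (div_ne_zero h1357 h1257) h1A h2A h2y h2z⟩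
  · have hB0 : B = 0 := by
      rw [h1257] at hB
      exact (mul_eq_zero.1 hB.symm).resolve_right h1357
    simp only [hB0, zero_mul, add_zero] at hM hrow
    exact ⟨A, funext hM, isSymmetricSquareOf_of_row_eq hrow,
      sagbi_hypersurface_of_row_eq hp hinj hrow⟩
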